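/- **Setting.** Consider the plant $$x_{t+1}=Fx_t+Gu_t+w_t,\qquad y_t=Hx_t+v_t\qquad(t\ge 0),$$ with state $x_t\in\mathbb R^{m_x}$, control $u_t\in\mathbb R^{m_u}$ and measurement $y_t\in\mathbb R^{m_y}$, where $(F,G)$ is controllable and the spectral radius satisfies $\rho(F)>1$. Assume that, for some invertible matrix $T$, the pair $(TFT^{-1},HT^{-1})$ is in the following canonical form (for instance, that $(F,H)$ itself is). The matrix $TFT^{-1}$ is $q\times q$ block lower triangular with blocks $F^{i,j}$ of size $\ell_i\times\ell_j$, $\sum_{i=1}^q\ell_i=m_x$. The diagonal block $F^{i,i}$ has first column $(-a_{i,1},\dots,-a_{i,\ell_i})^T$, ones on its first superdiagonal and zeros elsewhere. The first $q$ rows of $HT^{-1}$ form the block diagonal matrix with blocks $[1,0,\dots,0]$ of sizes $1\times\ell_i$; the remaining rows are arbitrary. The initial state and the noises are random, bounded by known constants, $\|x_0\|_\infty\le X_0$, $\|w_t\|_\infty<W/2$, $\|v_t\|_\infty<V/2$ for all $t$ (almost surely), and jointly independent of the randomness of the channel. **Communication.** The observer is connected to the controller by a channel with binary inputs that is used $n$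 times per time step. Its output block $z_t$ at time $t$ is determined by the channel's own randomness and the input blocks $c_0,\dots,c_t\in\{0,1\}^n$. A causal code consists of an encoder, which computes $c_t$ from the messages $b_0,\dots,b_t\in\{0,1\}^k$, and a decoder, which at time $t$ computes from $z_0,\dots,z_t$ estimates $\hat b_{\tau|t}$ of $b_\tau$ for all $\tau\le t$. The code is $(R,\beta)$-anytime reliable over the channel if $R=k/n$ and there are constants $d_o>0$ and $\eta$ such that, for every message sequence $(b_t)$, $$P\bigl(\min\{\tau:\hat b_{\tau|t}\ne b_\tau\}=t-d+1\bigr)\le \eta\,2^{-n\beta d}\qquad\text{for all } t,d\ge d_o \text{ with } d\le t+1,$$ where the probability is over the channel. **Theorem.** Let an $(R,\beta)$-anytime reliable code over the channel be given, with $$R>\frac1n\sum_{i=1}^q\max\Bigl\{0,\ \log_2\Bigl[\sqrt{m_x}\sum_{j=1}^{\ell_i}|a_{i,j}|\,\theta^{\,j-1}\Bigr]\Bigr\},\qquad \theta=\sqrt{\frac{m_x}{m_x-1}},\qquad\qquad \beta>\frac2n\log_2\rho(F)$$ (with $\log_2 0=-\infty$; for $m_x=1$ only $\theta^0=1$ occurs).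 Then the plant can be stabilized in the mean squared sense with this code: there are an observer, which computes $b_t$ from $y_0,\dots,y_t$ only (it has access neither to the channel outputs nor to the controls), and a controller, which computes $u_t$ from the estimates $\hat b_{\tau|s}$, $\tau\le s<t$, such that $$\limsup_{t\to\infty}\mathbb E\|x_t\|^2<\infty$$ for all initial states and noises as above. -/

import Mathlib

open MeasureTheory Filter
open scoped ENNReal Matrix

namespace AnytimeControl

section Communication

/-- A channel used `n` times per time step, with binary inputs and outputs in `𝒵`. All its
randomness is an element `ξ` of `Ξ` with law `law`; the output block at time `t` is a function of
`ξ` and of the input blocks up to time `t` (so memory is allowed, anticipation is not).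
A memoryless channel is the case `out t c ξ i = ξ t i (c t i)` with independent `ξ t i`. -/
structure Channel (n : ℕ) (𝒵 Ξ : Type*) [MeasurableSpace 𝒵] [MeasurableSpace Ξ] where
  law : Measure Ξ
  isProb : IsProbabilityMeasure law
  out : (t : ℕ) → (Fin (t + 1) → Fin n → ZMod 2) → Ξ → (Fin n → 𝒵)
  measurable_out : ∀ t c, Measurable (out t c)

/-- A causal encoder-decoder pair. The encoder maps the `k`-bit messages `b₀, …, b_t` to the
`n` channel inputs at time `t`. At time `t` the decoder maps the channel outputs `z₀, …, z_t` to
estimates of all the messages `b_τ`, `τ ≤ t`. -/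
structure Code (n k : ℕ) (𝒵 : Type*) [MeasurableSpace 𝒵] where
  enc : (t : ℕ) → (Fin (t + 1) → Fin k → ZMod 2) → (Fin n → ZMod 2)
  dec : (t : ℕ) → (Fin (t + 1) → Fin n → 𝒵) → (Fin (t + 1) → Fin k → ZMod 2)
  measurable_dec : ∀ t τ m, MeasurableSet {z | dec t z τ = m}

variable {n k : ℕ} {𝒵 Ξ : Type*} [MeasurableSpace 𝒵] [MeasurableSpace Ξ]

/-- The estimates `τ ↦ b̂_{τ|t}` made at time `t` when the messages are `b` and the channel
randomness is `ξ`. -/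
def estimates (ch : Channel n 𝒵 Ξ) (code : Code n k 𝒵) (b : ℕ → Fin k → ZMod 2) (ξ : Ξ)
    (t : ℕ) : Fin (t + 1) → Fin k → ZMod 2 :=
  code.dec t fun s => ch.out s (fun r => code.enc r fun l => b l) ξ

/-- The event that the earliest error among the estimates made at time `t` is at time `τ`. -/
def firstErrorAt (ch : Channel n 𝒵 Ξ) (code : Code n k 𝒵) (b : ℕ → Fin k → ZMod 2)
    (t : ℕ) (τ : Fin (t + 1)) : Set Ξ :=
  {ξ | estimates ch code b ξ t τ ≠ b τ ∧ ∀ σ < τ, estimates ch code b ξ t σ = b σ}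

/-- `(R, β, d₀)`-anytime reliability of an encoder-decoder pair over a channel: the rate is
`R = k / n`, and for some constant `η`, whatever the messages, the probability (over the channel)
that the earliest error at time `t` is at time `t - d + 1` is at most `η 2^{-nβd}`, for all
`t, d ≥ d₀`. -/
def IsAnytimeReliableFrom (ch : Channel n 𝒵 Ξ) (code : Code n k 𝒵) (R β : ℝ) (d₀ : ℕ) : Prop :=
  R = (k : ℝ) / n ∧
  ∃ η : ℝ, ∀ (b : ℕ → Fin k → ZMod 2) (t d : ℕ) (τ : Fin (t + 1)),
    d₀ ≤ t → d₀ ≤ d → (τ : ℕ) + d = t + 1 →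
      ch.law (firstErrorAt ch code b t τ) ≤ ENNReal.ofReal (η * (2 : ℝ) ^ (-(n * β * d)))

/-- `(R, β)`-anytime reliability: `(R, β, d₀)`-anytime reliability for some `d₀ > 0`. -/
def IsAnytimeReliable (ch : Channel n 𝒵 Ξ) (code : Code n k 𝒵) (R β : ℝ) : Prop :=
  ∃ d₀ : ℕ, 0 < d₀ ∧ IsAnytimeReliableFrom ch code R β d₀

end Communication

section Plant

/-- What has to be designed, given the code. The observer computes the message `b_t` from the
measurements `y₀, …, y_t` alone (it sees neither the controls nor the channel outputs).
The controller computes `u_t` from the estimates `b̂_{τ|s}`, `τ ≤ s < t`, made before time `t`. -/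
structure Scheme (Y U : Type*) (k : ℕ) where
  observer : (t : ℕ) → (Fin (t + 1) → Y → ℝ) → (Fin k → ZMod 2)
  measurable_observer : ∀ t m, MeasurableSet {y | observer t y = m}
  controller : (t : ℕ) → ((s : Fin t) → Fin (s + 1) → Fin k → ZMod 2) → (U → ℝ)

variable {X Y U : Type*} [Fintype X] [Fintype U]
  {n k : ℕ} {𝒵 Ξ : Type*} [MeasurableSpace 𝒵] [MeasurableSpace Ξ]

/-- The control `u_t` that results from the states `x₀, …, x_{t-1}`: these are measured as
`y_s = H x_s + v_s`, turned into messages, encoded, sent, decoded and fed to the controller. -/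
def control (H : Matrix Y X ℝ) (ch : Channel n 𝒵 Ξ) (code : Code n k 𝒵) (S : Scheme Y U k)
    (v : ℕ → Y → ℝ) (ξ : Ξ) (x : ℕ → X → ℝ) (t : ℕ) : U → ℝ :=
  S.controller t fun s =>
    estimates ch code (fun r => S.observer r fun l => H *ᵥ x l + v l) ξ s

/-- The states up to time `t` of the closed loop (constant after time `t`, where they have not been
computed yet). -/
def closedLoopUpTo (F : Matrix X X ℝ) (G : Matrix X U ℝ) (H : Matrix Y X ℝ)
    (ch : Channel n 𝒵 Ξ) (code : Code n k 𝒵) (S : Scheme Y U k)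
    (x₀ : X → ℝ) (w : ℕ → X → ℝ) (v : ℕ → Y → ℝ) (ξ : Ξ) : ℕ → ℕ → X → ℝ
  | 0 => fun _ => x₀
  | t + 1 => fun s =>
      let x := closedLoopUpTo F G H ch code S x₀ w v ξ t
      if s ≤ t then x s else F *ᵥ x t + G *ᵥ control H ch code S v ξ x t + w t

/-- The state `x_t` of the closed loop `x_{t+1} = F x_t + G u_t + w_t`, `y_t = H x_t + v_t`, with
initial state `x₀`, in which the controls `u_t` are those of `control`. -/
def closedLoopState (F : Matrix X X ℝ) (G : Matrix X U ℝ) (H : Matrix Y X ℝ)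
    (ch : Channel n 𝒵 Ξ) (code : Code n k 𝒵) (S : Scheme Y U k)
    (x₀ : X → ℝ) (w : ℕ → X → ℝ) (v : ℕ → Y → ℝ) (ξ : Ξ) (t : ℕ) : X → ℝ :=
  closedLoopUpTo F G H ch code S x₀ w v ξ t t

/-- The state at time `s` does not change any more after time `s`. -/
theorem closedLoopUpTo_eq (F : Matrix X X ℝ) (G : Matrix X U ℝ) (H : Matrix Y X ℝ)
    (ch : Channel n 𝒵 Ξ) (code : Code n k 𝒵) (S : Scheme Y U k)
    (x₀ : X → ℝ) (w : ℕ → X → ℝ) (v : ℕ → Y → ℝ) (ξ : Ξ) (t s : ℕ) (h : s ≤ t) :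
    closedLoopUpTo F G H ch code S x₀ w v ξ t s = closedLoopState F G H ch code S x₀ w v ξ s := by
  induction t with
  | zero => obtain rfl : s = 0 := by omega
            rfl
  | succ t ih =>
    rcases Nat.lt_or_ge t s with h' | h'
    · obtain rfl : s = t + 1 := by omega
      rfl
    · rw [← ih h']
      simp [closedLoopUpTo, h']

/-- `closedLoopState` does satisfy the equation of the plant with the controls of the loop. -/
theorem closedLoopState_succ (F : Matrix X X ℝ) (G : Matrix X U ℝ) (H : Matrix Y X ℝ)
    (ch : Channel n 𝒵 Ξ) (code : Code n k 𝒵) (S : Scheme Y U k)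
    (x₀ : X → ℝ) (w : ℕ → X → ℝ) (v : ℕ → Y → ℝ) (ξ : Ξ) (t : ℕ) :
    closedLoopState F G H ch code S x₀ w v ξ (t + 1) =
      F *ᵥ closedLoopState F G H ch code S x₀ w v ξ t +
        G *ᵥ control H ch code S v ξ (closedLoopState F G H ch code S x₀ w v ξ) t + w t := by
  have key : control H ch code S v ξ (closedLoopUpTo F G H ch code S x₀ w v ξ t) t =
      control H ch code S v ξ (closedLoopState F G H ch code S x₀ w v ξ) t := by
    unfold control estimates
    congr 1
    funext s
    congr 1
    funext r
    congr 1
    funext j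
    congr 1
    funext m
    have hm : (m : ℕ) ≤ t := by omega
    simp only
    congr 1
    funext l
    rw [closedLoopUpTo_eq _ _ _ _ _ _ _ _ _ _ _ _ (by omega)]
  rw [← key]
  simp [closedLoopState, closedLoopUpTo]

/-- The scheme `S` stabilizes the plant in the mean squared sense: `limsup_t E‖x_t‖² < ∞` for all
random initial states bounded by `X₀` and all random noises with `‖w_t‖_∞ < W / 2` and
`‖v_t‖_∞ < V / 2`, independent of the channel (whence the product measure).
The norm of `X → ℝ` and `Y → ℝ` is the sup norm. -/
def StabilizesMeanSquare [Fintype Y] (F : Matrix X X ℝ) (G : Matrix X U ℝ) (H : Matrix Y X ℝ)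
    (ch : Channel n 𝒵 Ξ) (code : Code n k 𝒵) (W V X₀ : ℝ) (S : Scheme Y U k) : Prop :=
  ∀ (Ω : Type*) [MeasurableSpace Ω] (P : Measure Ω) [IsProbabilityMeasure P]
    (x₀ : Ω → X → ℝ) (w : ℕ → Ω → X → ℝ) (v : ℕ → Ω → Y → ℝ),
    Measurable x₀ → (∀ t, Measurable (w t)) → (∀ t, Measurable (v t)) →
    (∀ᵐ ω ∂P, ‖x₀ ω‖ ≤ X₀) →
    (∀ t, ∀ᵐ ω ∂P, ‖w t ω‖ < W / 2) → (∀ t, ∀ᵐ ω ∂P, ‖v t ω‖ < V / 2) →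
    limsup (fun t : ℕ =>
      ∫⁻ p, ENNReal.ofReal (∑ i, closedLoopState F G H ch code S (x₀ p.1)
        (fun s => w s p.1) (fun s => v s p.1) p.2 t i ^ 2) ∂(P.prod ch.law)) atTop < ⊤

/-- `(F, G)` is controllable: the columns of `G, FG, …, F^{m-1}G` span the state space of
dimension `m`. -/
def IsControllable [DecidableEq X] (F : Matrix X X ℝ) (G : Matrix X U ℝ) : Prop :=
  Submodule.span ℝ {x | ∃ j < Fintype.card X, ∃ u, x = (F ^ j * G) *ᵥ u} = ⊤

/-- The spectral radius of a real matrix (over its complex eigenvalues). -/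
noncomputable def specRadius [DecidableEq X] (F : Matrix X X ℝ) : ℝ :=
  (spectralRadius ℂ (F.map Complex.ofReal)).toReal

end Plant

section Canonical

/-- Coordinates of the state space, in `q` blocks of sizes `ℓ i`. -/
abbrev Idx {q : ℕ} (ℓ : Fin q → ℕ) : Type := (i : Fin q) × Fin (ℓ i)

/-- The canonical form: `F` is block lower triangular, its `i`-th diagonal block has first column
`-a_{i,1}, …, -a_{i,ℓ_i}`, ones above the diagonal and zeros elsewhere; and the first `q` rows of `H`
are block diagonal with blocks `[1, 0, …, 0]` of size `1 × ℓ_i`. The other `r` rows of `H` are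
arbitrary. Here `a i j` is the coefficient `a_{i,j+1}`. -/
structure IsCanonicalForm {q r : ℕ} {ℓ : Fin q → ℕ} (a : (i : Fin q) → Fin (ℓ i) → ℝ)
    (F : Matrix (Idx ℓ) (Idx ℓ) ℝ) (H : Matrix (Fin q ⊕ Fin r) (Idx ℓ) ℝ) : Prop where
  upper : ∀ (i i' : Fin q) (j : Fin (ℓ i)) (j' : Fin (ℓ i')), i < i' → F ⟨i, j⟩ ⟨i', j'⟩ = 0
  diag : ∀ (i : Fin q) (j j' : Fin (ℓ i)), F ⟨i, j⟩ ⟨i, j'⟩ =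
    if (j' : ℕ) = 0 then -a i j else if (j' : ℕ) = j + 1 then 1 else 0
  meas : ∀ (i i' : Fin q) (j' : Fin (ℓ i')), H (Sum.inl i) ⟨i', j'⟩ =
    if i = i' ∧ (j' : ℕ) = 0 then 1 else 0

/-- `θ = √(m / (m - 1))`. For `m = 1` this is a junk value, but then only `θ ^ 0 = 1` is used. -/
noncomputable def theta (m : ℕ) : ℝ := √((m : ℝ) / ((m : ℝ) - 1))

/-- The rate threshold
`(1/n) ∑_{i=1}^q max {0, log₂ [√m ∑_{j=1}^{ℓ_i} |a_{i,j}| θ^{j-1}]}`, where `m = ∑ ℓ_i`.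
If all `a_{i,j}` of a block vanish, the logarithm is `-∞` in the formula and `0` in the code, and
the maximum is `0` in both. -/
noncomputable def rateThreshold (n : ℕ) {q : ℕ} {ℓ : Fin q → ℕ}
    (a : (i : Fin q) → Fin (ℓ i) → ℝ) : ℝ :=
  (1 / n) * ∑ i, max 0 (Real.logb 2
    (√((∑ i', ℓ i' : ℕ) : ℝ) * ∑ j : Fin (ℓ i), |a i j| * theta (∑ i', ℓ i') ^ (j : ℕ)))

end Canonical

end AnytimeControl

set_option linter.unusedSectionVars false

/-! The difficulty is that the observer sees neither the controls nor what was decoded. The controls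
themselves are made to tell it. Time is cut into periods of `P` steps, each beginning with `M` idle
steps, and the total effect of the controls of a period on the state is one vector, its
displacement, taken from a lattice. Measurements in the idle steps of two successive periods give
the displacement up to an error due to the noises alone. The mesh exceeds twice that error, so
rounding recovers the displacement exactly, even when the controller acts on wrong messages
(`Design.observedDisplacement_eq`). Subtracting the response to the controls leaves the measurements
of the uncontrolled plant, and the messages become a function of the initial state and the noises
only (`Design.closedLoop_eq`). They are thus fixed once the plant noises are fixed, and anytime
reliability, a statement about each single message sequence, can be applied inside the product
measure.

The controller tracks the uncontrolled state with a delay of two periods, predicts it to the end of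
the current period and cancels it up to rounding. Up to a bounded remainder the state is then
controlled by the effect of decoding errors. If the first wrong message is `d` steps old, this
effect is at most a constant times `r ^ d`, where `r` is slightly above the spectral radius; the
probability is at most a constant times `2 ^ (-nβd)`. Since `2 ^ (-nβ) * r ^ 2 < 1`, the second
moments are bounded by a geometric series (`Design.exists_lintegral_sq_decodingError_le`).

It remains to estimate an unstable uncontrolled plant with `k` bits per step. In canonical
coordinates only the first coordinate of the error in each block is quantized. A box of errors is
invariant as soon as block `i` has `2 ^ κ i > ∑ j, |a i j|` levels (`exists_invariant_box`,
`IsCanonicalForm.exists_estimator`), and the rate threshold leaves room for such integers `κ i`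
(`exists_bit_allocation`). -/

namespace AnytimeControl

/-! ### Growth of matrix powers -/

section Growth

attribute [local instance] Matrix.linftyOpNormedAddCommGroup Matrix.linftyOpNormedRing
  Matrix.linftyOpNormedSpace Matrix.linftyOpNormedAlgebra

variable {X Y : Type*} [Fintype X] [Fintype Y]

/-- Multiplication by a fixed matrix is bounded in the sup norm. -/
theorem exists_norm_mulVec_le (A : Matrix Y X ℝ) : ∃ c, 0 ≤ c ∧ ∀ v, ‖A *ᵥ v‖ ≤ c * ‖v‖ :=
  ⟨‖A‖, norm_nonneg _, Matrix.linfty_opNorm_mulVec A⟩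

theorem norm_map_ofReal (A : Matrix X X ℝ) : ‖A.map Complex.ofReal‖ = ‖A‖ := by
  simp [Matrix.linfty_opNorm_def]

/-- By Gelfand's formula the powers of `F` grow at most like `r ^ j` for each `r` above the
spectral radius. -/
theorem exists_norm_pow_mulVec_le [DecidableEq X] (F : Matrix X X ℝ) {r : ℝ}
    (h0 : 0 < specRadius F) (hr : specRadius F < r) :
    ∃ C, 0 ≤ C ∧ ∀ (j : ℕ) (v : X → ℝ), ‖(F ^ j) *ᵥ v‖ ≤ C * r ^ j * ‖v‖ := by
  have hr0 : 0 < r := h0.trans hr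
  have hfin : spectralRadius ℂ (F.map Complex.ofReal) ≠ ⊤ := by
    intro h
    simp [specRadius, h] at h0
  have hlt : spectralRadius ℂ (F.map Complex.ofReal) < ENNReal.ofReal r :=
    (ENNReal.lt_ofReal_iff_toReal_lt hfin).2 hr
  have hpow : ∀ j : ℕ, ‖(F.map Complex.ofReal) ^ j‖ = ‖F ^ j‖ := by
    intro j
    rw [← norm_map_ofReal (F ^ j)]
    congr 1
    exact (map_pow (Complex.ofRealHom.mapMatrix (m := X)) F j).symm
  have hev := (spectrum.pow_nnnorm_pow_one_div_tendsto_nhds_spectralRadius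
    (F.map Complex.ofReal)).eventually_lt_const hlt
  obtain ⟨n₀, hn₀⟩ := (hev.and (eventually_gt_atTop 0)).exists_forall_of_atTop
  have hlarge : ∀ j, n₀ ≤ j → ‖F ^ j‖ ≤ r ^ j := by
    intro j hj
    obtain ⟨h1, h2⟩ := hn₀ j hj
    have h3 := ENNReal.rpow_le_rpow h1.le (Nat.cast_nonneg j)
    rw [← ENNReal.rpow_mul, one_div, inv_mul_cancel₀ (by positivity), ENNReal.rpow_one,
      ENNReal.rpow_natCast, ← ENNReal.ofReal_pow hr0.le] at h3
    have h4 := (ENNReal.toReal_le_toReal (by simp) (by simp)).2 h3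
    rw [ENNReal.toReal_ofReal (by positivity)] at h4
    rw [← hpow]
    simpa using h4
  -- Gelfand's formula gives the constant `1` from `n₀` on; the sum absorbs the finitely many
  -- earlier powers.
  refine ⟨1 + ∑ j ∈ Finset.range n₀, ‖F ^ j‖ / r ^ j, by positivity, fun j v => ?_⟩
  refine (Matrix.linfty_opNorm_mulVec _ v).trans ?_
  gcongr
  rcases le_or_gt n₀ j with hj | hj
  · calc ‖F ^ j‖ ≤ 1 * r ^ j := by simpa using hlarge j hj
      _ ≤ _ := by
        gcongr
        have : 0 ≤ ∑ j ∈ Finset.range n₀, ‖F ^ j‖ / r ^ j := by positivity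
        linarith
  · calc ‖F ^ j‖ = (‖F ^ j‖ / r ^ j) * r ^ j := by field_simp
      _ ≤ _ := by
        gcongr
        have := Finset.single_le_sum (f := fun j => ‖F ^ j‖ / r ^ j)
          (fun i _ => by positivity) (Finset.mem_range.2 hj)
        linarith

end Growth

/-! ### Rounding to a lattice -/

section Rounding

variable {X : Type*} [Fintype X]

/-- Coordinatewise rounding to the lattice of mesh `δ`. -/
noncomputable def latticeRound (δ : ℝ) (v : X → ℝ) : X → ℝ := fun i => δ * round (v i / δ)

theorem norm_latticeRound_sub_le {δ : ℝ} (hδ : 0 < δ) (v : X → ℝ) :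
    ‖latticeRound δ v - v‖ ≤ δ := by
  rw [pi_norm_le_iff_of_nonneg hδ.le]
  intro i
  have h := abs_sub_round (v i / δ)
  have e : (latticeRound δ v - v) i = -(δ * (v i / δ - round (v i / δ))) := by
    simp only [latticeRound, Pi.sub_apply]
    field_simp
    ring
  rw [e, norm_neg, norm_mul, Real.norm_of_nonneg hδ.le, Real.norm_eq_abs]
  nlinarith

/-- A lattice point can be recovered from a perturbation that is small compared to the mesh. -/
theorem latticeRound_add_of_norm_lt {δ : ℝ} (hδ : 0 < δ) (v e : X → ℝ) (he : 2 * ‖e‖ < δ) :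
    latticeRound δ (latticeRound δ v + e) = latticeRound δ v := by
  funext i
  have h1 : |e i| ≤ ‖e‖ := norm_le_pi_norm e i
  have h2 := abs_le.1 h1
  have h3 : round (e i / δ) = 0 := by
    rw [round_eq_zero_iff]
    constructor
    · rw [le_div_iff₀ hδ]; linarith
    · rw [div_lt_iff₀ hδ]; linarith
  have h4 : (latticeRound δ v + e) i / δ = (round (v i / δ) : ℤ) + e i / δ := by
    simp only [latticeRound, Pi.add_apply]
    field_simp
  change δ * (round ((latticeRound δ v + e) i / δ) : ℝ) = _
  rw [h4, round_intCast_add, h3, add_zero]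
  rfl

theorem measurable_latticeRound {X : Type*} (δ : ℝ) : Measurable (latticeRound (X := X) δ) := by
  refine measurable_pi_lambda _ fun i => ?_
  have h : Measurable (fun x : ℝ => ((round x : ℤ) : ℝ)) := by
    simp only [round_eq]
    exact (measurable_from_top (f := fun z : ℤ => (z : ℝ))).comp
      (Int.measurable_floor.comp (measurable_id.add_const _))
  have hi : Measurable fun v : X → ℝ => v i / δ := by fun_prop
  exact (h.comp hi).const_mul δ

end Rounding

/-! ### Observability and controllability -/

section LinearSystems

variable {X Y U : Type*} [Fintype X] [Fintype U] [DecidableEq X]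

/-- If no nonzero state is invisible in the measurements, the state is a linear function of
finitely many measurements. -/
theorem exists_leftInverse_of_observable [Fintype Y] (F : Matrix X X ℝ) (H : Matrix Y X ℝ)
    (hobs : ∀ x, (∀ j : ℕ, H *ᵥ ((F ^ j) *ᵥ x) = 0) → x = 0) :
    ∃ (M : ℕ) (Λ : (Fin M → Y → ℝ) →ₗ[ℝ] (X → ℝ)),
      ∀ x, Λ (fun j => H *ᵥ ((F ^ (j : ℕ)) *ᵥ x)) = x := by
  let O : (M : ℕ) → (X → ℝ) →ₗ[ℝ] (Fin M → Y → ℝ) := fun M =>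
    LinearMap.pi fun j => (Matrix.mulVecLin H).comp (Matrix.mulVecLin (F ^ (j : ℕ)))
  have hmem : ∀ M x, x ∈ LinearMap.ker (O M) ↔ ∀ j < M, H *ᵥ ((F ^ j) *ᵥ x) = 0 := by
    intro M x
    rw [LinearMap.mem_ker, funext_iff]
    exact ⟨fun h j hj => h ⟨j, hj⟩, fun h j => h j j.2⟩
  let f : ℕ →o (Submodule ℝ (X → ℝ))ᵒᵈ :=
    { toFun := fun M => OrderDual.toDual (LinearMap.ker (O M))
      monotone' := fun M N hMN => by
        change LinearMap.ker (O N) ≤ LinearMap.ker (O M)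
        intro x hx
        rw [hmem] at hx ⊢
        exact fun j hj => hx j (hj.trans_le hMN) }
  -- The kernels decrease with the number of measurements, hence stabilize. A vector in the final
  -- kernel is invisible forever.
  obtain ⟨M, hM⟩ := IsArtinian.monotone_stabilizes f
  have hker : LinearMap.ker (O M) = ⊥ := by
    rw [eq_bot_iff]
    intro x hx
    refine hobs x fun j => ?_
    have e : LinearMap.ker (O M) = LinearMap.ker (O (M + j + 1)) := hM (M + j + 1) (by omega)
    rw [e, hmem] at hx
    exact hx j (by omega)
  obtain ⟨Λ, hΛ⟩ := (O M).exists_leftInverse_of_injective hker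
  exact ⟨M, Λ, fun x => LinearMap.congr_fun hΛ x⟩

/-- Over a period that starts with `M` idle steps, a controllable plant can be moved by any vector,
with controls that are linear in this vector. -/
theorem exists_controls_of_controllable (F : Matrix X X ℝ) (G : Matrix X U ℝ)
    (h : IsControllable F G) (M : ℕ) :
    ∃ (P : ℕ) (K : ℕ → (X → ℝ) →ₗ[ℝ] (U → ℝ)), M < P ∧ (∀ j < M, K j = 0) ∧
      ∀ ζ, ∑ j ∈ Finset.range P, (F ^ (P - 1 - j)) *ᵥ (G *ᵥ K j ζ) = ζ := by
  set m := Fintype.card X with hm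
  let L : (Fin m → U → ℝ) →ₗ[ℝ] (X → ℝ) :=
    ∑ j : Fin m, (Matrix.mulVecLin (F ^ (j : ℕ) * G)).comp (LinearMap.proj j)
  have hL : ∀ f, L f = ∑ j : Fin m, (F ^ (j : ℕ) * G) *ᵥ f j := fun f => by
    simp [L, LinearMap.sum_apply]
  have hsurj : LinearMap.range L = ⊤ := by
    rw [eq_top_iff, ← h, Submodule.span_le]
    rintro x ⟨j, hj, u, rfl⟩
    refine ⟨Pi.single ⟨j, hj⟩ u, ?_⟩
    rw [hL, Finset.sum_eq_single ⟨j, hj⟩]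
    · simp
    · intro b _ hb
      simp [Pi.single_eq_of_ne hb]
    · simp
  obtain ⟨K, hK⟩ := L.exists_rightInverse_of_surjective hsurj
  have hK' : ∀ ζ, L (K ζ) = ζ := fun ζ => LinearMap.congr_fun hK ζ
  -- The active steps are the last `m` ones. With `P = m + 1 + M`, the control at step `j` is
  -- multiplied by `F ^ (P - 1 - j) = F ^ (m + M - j)`, which explains its index. The additional
  -- idle step makes `M < P` also for `m = 0`.
  refine ⟨m + 1 + M, fun j => if hj : j ≤ M then 0 else
    if hj' : m + M - j < m then (LinearMap.proj ⟨m + M - j, hj'⟩).comp K else 0, by omega,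
    fun j hj => by simp [hj.le], fun ζ => ?_⟩
  conv_rhs => rw [← hK' ζ, hL]
  rw [← Finset.sum_range_reflect]
  rw [show m + 1 + M = m + (1 + M) by omega, Finset.sum_range_add, Finset.sum_range]
  rw [Finset.sum_eq_zero (s := Finset.range (1 + M)), add_zero]
  · refine Finset.sum_congr rfl fun j _ => ?_
    have hj := j.2
    have h1 : ¬ (m + (1 + M) - 1 - (j : ℕ) ≤ M) := by omega
    have h2 : m + M - (m + (1 + M) - 1 - (j : ℕ)) = j := by omega
    have h3 : m + (1 + M) - 1 - (m + (1 + M) - 1 - (j : ℕ)) = j := by omega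
    simp only [h1, dif_neg, not_false_eq_true, h2, h3, hj, dif_pos, LinearMap.comp_apply,
      LinearMap.proj_apply, Matrix.mulVec_mulVec]
  · intro j hj
    have h1 : m + (1 + M) - 1 - (m + j) ≤ M := by omega
    simp [h1]

theorem exists_norm_linearMap_le {E₁ E₂ : Type*} [NormedAddCommGroup E₁] [NormedSpace ℝ E₁]
    [FiniteDimensional ℝ E₁] [NormedAddCommGroup E₂] [NormedSpace ℝ E₂] (L : E₁ →ₗ[ℝ] E₂) :
    ∃ c, 0 ≤ c ∧ ∀ v, ‖L v‖ ≤ c * ‖v‖ :=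
  ⟨‖LinearMap.toContinuousLinearMap L‖, norm_nonneg _,
    fun v => (LinearMap.toContinuousLinearMap L).le_opNorm v⟩

end LinearSystems

/-! ### Linear recursions and their responses to inputs -/

section Trajectories

variable {X : Type*} [Fintype X]

/-- The trajectory of `x_{t+1} = F x_t + u_t` from `x₀`. -/
def trajectory (F : Matrix X X ℝ) (x₀ : X → ℝ) (u : ℕ → X → ℝ) : ℕ → X → ℝ
  | 0 => x₀
  | t + 1 => F *ᵥ trajectory F x₀ u t + u t

/-- The contribution of the inputs at times `t, …, t + j - 1` to the state at time `t + j`. -/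
def inputResponse [DecidableEq X] (F : Matrix X X ℝ) (u : ℕ → X → ℝ) (t j : ℕ) : X → ℝ :=
  ∑ i ∈ Finset.range j, (F ^ (j - 1 - i)) *ᵥ u (t + i)

theorem inputResponse_succ [DecidableEq X] (F : Matrix X X ℝ) (u : ℕ → X → ℝ) (t j : ℕ) :
    inputResponse F u t (j + 1) = F *ᵥ inputResponse F u t j + u (t + j) := by
  simp only [inputResponse, Finset.sum_range_succ, Nat.add_sub_cancel, Nat.sub_self, pow_zero,
    Matrix.one_mulVec, Matrix.mulVec_sum, Matrix.mulVec_mulVec, ← pow_succ']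
  congr 1
  refine Finset.sum_congr rfl fun i hi => ?_
  have := Finset.mem_range.1 hi
  rw [show j - i = j - 1 - i + 1 by omega]

theorem inputResponse_add [DecidableEq X] (F : Matrix X X ℝ) (u u' : ℕ → X → ℝ) (t j : ℕ) :
    inputResponse F (fun s => u s + u' s) t j =
      inputResponse F u t j + inputResponse F u' t j := by
  simp only [inputResponse, Matrix.mulVec_add, Finset.sum_add_distrib]

theorem state_add_eq [DecidableEq X] {F : Matrix X X ℝ} {x u : ℕ → X → ℝ}
    (h : ∀ t, x (t + 1) = F *ᵥ x t + u t) (t j : ℕ) :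
    x (t + j) = (F ^ j) *ᵥ x t + inputResponse F u t j := by
  induction j with
  | zero => simp [inputResponse]
  | succ j ih =>
    rw [← add_assoc, h, ih, inputResponse_succ, Matrix.mulVec_add, Matrix.mulVec_mulVec,
      ← pow_succ', add_assoc]

theorem trajectory_congr {F : Matrix X X ℝ} {x₀ : X → ℝ} {u u' : ℕ → X → ℝ} (t : ℕ)
    (h : ∀ s < t, u s = u' s) : trajectory F x₀ u t = trajectory F x₀ u' t := by
  induction t with
  | zero => rfl
  | succ t ih =>
    simp only [trajectory]
    rw [ih fun s hs => h s (by omega), h t (by omega)]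

theorem trajectory_add (F : Matrix X X ℝ) (x₀ x₀' : X → ℝ) (u u' : ℕ → X → ℝ) (t : ℕ) :
    trajectory F (x₀ + x₀') (fun s => u s + u' s) t =
      trajectory F x₀ u t + trajectory F x₀' u' t := by
  induction t with
  | zero => rfl
  | succ t ih =>
    simp only [trajectory, ih, Matrix.mulVec_add]
    abel

theorem eq_trajectory {F : Matrix X X ℝ} {x u : ℕ → X → ℝ}
    (h : ∀ t, x (t + 1) = F *ᵥ x t + u t) (t : ℕ) : x t = trajectory F (x 0) u t := by
  induction t with
  | zero => rfl
  | succ t ih => rw [h, ih]; rfl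

/-- Inputs which start `d` steps ago have an effect that grows like the powers of the plant. -/
theorem norm_inputResponse_le [DecidableEq X] {F : Matrix X X ℝ} {C r B : ℝ} (hC : 0 ≤ C)
    (hr : 1 < r) (hF : ∀ (j : ℕ) (v : X → ℝ), ‖(F ^ j) *ᵥ v‖ ≤ C * r ^ j * ‖v‖)
    {u : ℕ → X → ℝ} (t : ℕ) (hu : ∀ s, t ≤ s → ‖u s‖ ≤ B) (j : ℕ) :
    ‖inputResponse F u t j‖ ≤ C * B / (r - 1) * r ^ j := by
  have hB : 0 ≤ B := (norm_nonneg _).trans (hu t le_rfl)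
  have hr1 : 0 < r - 1 := by linarith
  calc ‖inputResponse F u t j‖
      ≤ ∑ i ∈ Finset.range j, C * r ^ (j - 1 - i) * B := by
        refine norm_sum_le_of_le _ fun i _ => (hF _ _).trans ?_
        gcongr
        exact hu _ (by omega)
    _ = C * B * ∑ i ∈ Finset.range j, r ^ i := by
        rw [Finset.sum_range_reflect (fun i => C * r ^ i * B), Finset.mul_sum]
        exact Finset.sum_congr rfl fun i _ => by ring
    _ = C * B * ((r ^ j - 1) / (r - 1)) := by rw [geom_sum_eq hr.ne']
    _ ≤ C * B * (r ^ j / (r - 1)) := by gcongr; linarith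
    _ = _ := by ring

end Trajectories

/-! ### The observer and the controller -/

/-- The parameters of the scheme. Time is divided into periods of `P` steps. The controls of a
period are the images under `K` of a single vector, its displacement. A state is recovered from `M`
measurements by `Λ`, and displacements are rounded to the lattice of mesh `δ`. The maps `enc` and
`dec` turn an innovation of the measurement into a message and the message into a correction of the
state estimate. -/
structure Design (X Y U : Type*) [Fintype X] (k : ℕ) where
  F : Matrix X X ℝ
  H : Matrix Y X ℝ
  G : Matrix X U ℝ
  P : ℕ
  M : ℕ
  K : ℕ → (X → ℝ) →ₗ[ℝ] (U → ℝ)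
  Λ : (Fin M → Y → ℝ) →ₗ[ℝ] (X → ℝ)
  δ : ℝ
  enc : (Y → ℝ) → (Fin k → ZMod 2)
  dec : (Fin k → ZMod 2) → (X → ℝ)
  measurable_enc : ∀ m, MeasurableSet {y | enc y = m}

namespace Design

variable {X Y U : Type*} [Fintype X] [Fintype Y] [Fintype U] [DecidableEq X] {k : ℕ}
  (d : Design X Y U k)

/-- The response of the state to the controls with displacements `ζ`. -/
def controlResponse (ζ : ℕ → X → ℝ) : ℕ → X → ℝ :=
  trajectory d.F 0 fun t => d.G *ᵥ d.K (t % d.P) (ζ (t / d.P))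

/-- The estimate of the state of an uncontrolled plant from its measurements `y`. -/
def estimate (y : ℕ → Y → ℝ) : ℕ → X → ℝ
  | 0 => 0
  | t + 1 => d.F *ᵥ estimate y t + d.dec (d.enc (y t - d.H *ᵥ estimate y t))

/-- The messages about an uncontrolled plant with measurements `y`, delayed by two periods. -/
def message (y : ℕ → Y → ℝ) (t : ℕ) : Fin k → ZMod 2 :=
  if t < 2 * d.P then 0
  else d.enc (y (t - 2 * d.P) - d.H *ᵥ d.estimate y (t - 2 * d.P))

/-- The state estimate, delayed by two periods, that is computed from messages. -/
def decodedEstimate (b : ℕ → Fin k → ZMod 2) : ℕ → X → ℝ :=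
  trajectory d.F 0 fun t => if t < 2 * d.P then 0 else d.dec (b t)

/-- The displacement in period `s`, reconstructed from the measurements. -/
noncomputable def observedDisplacement (y : ℕ → Y → ℝ) (s : ℕ) : X → ℝ :=
  latticeRound d.δ (d.Λ (fun j => y ((s + 1) * d.P + j)) -
    (d.F ^ d.P) *ᵥ d.Λ (fun j => y (s * d.P + j)))

/-- The measurements after removal of the response to the controls. -/
noncomputable def uncontrolled (y : ℕ → Y → ℝ) (t : ℕ) : Y → ℝ :=
  y t - d.H *ᵥ d.controlResponse (d.observedDisplacement y) t

/-- The displacement chosen in period `s`, when the response of the state to the previous controls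
is `c` and the messages have been decoded as `b`. -/
noncomputable def displacement (c : X → ℝ) (b : ℕ → Fin k → ZMod 2) (s : ℕ) : X → ℝ :=
  latticeRound d.δ (-((d.F ^ d.P) *ᵥ (c +
    (d.F ^ (2 * d.P)) *ᵥ d.decodedEstimate b (s * d.P))))

/-- The response of the state at the start of period `s` to the controls that are computed from the
estimates `e`. -/
noncomputable def periodResponse (e : ℕ → ℕ → Fin k → ZMod 2) : ℕ → X → ℝ
  | 0 => 0
  | s + 1 => (d.F ^ d.P) *ᵥ periodResponse e s +
      d.displacement (periodResponse e s) (e (s * d.P - 1)) s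

/-- The displacement in period `s` that is computed from the estimates `e`. -/
noncomputable def displacements (e : ℕ → ℕ → Fin k → ZMod 2) (s : ℕ) : X → ℝ :=
  d.displacement (d.periodResponse e s) (e (s * d.P - 1)) s

theorem decodedEstimate_congr {b b' : ℕ → Fin k → ZMod 2} (t : ℕ) (h : ∀ s < t, b s = b' s) :
    d.decodedEstimate b t = d.decodedEstimate b' t :=
  trajectory_congr t fun s hs => by rw [h s hs]

theorem periodResponse_congr {e e' : ℕ → ℕ → Fin k → ZMod 2} (s : ℕ)
    (h : ∀ σ < s * d.P, ∀ τ ≤ σ, e σ τ = e' σ τ) :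
    d.periodResponse e s = d.periodResponse e' s ∧ d.displacements e s = d.displacements e' s := by
  have key : ∀ s, (∀ σ < s * d.P, ∀ τ ≤ σ, e σ τ = e' σ τ) →
      d.periodResponse e s = d.periodResponse e' s →
        d.displacements e s = d.displacements e' s := by
    intro s h hs
    unfold displacements displacement
    -- For `s = 0` the truncated index `s * P - 1` does no harm: the decoded estimate at time `0`
    -- uses no message.
    rw [hs, d.decodedEstimate_congr (s * d.P) fun τ hτ => h _ (by omega) τ (by omega)]
  induction s with
  | zero => exact ⟨rfl, key 0 h rfl⟩
  | succ s ih =>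
    have hle : s * d.P ≤ (s + 1) * d.P := Nat.mul_le_mul_right _ (by omega)
    obtain ⟨h1, h2⟩ := ih fun σ hσ => h σ (by omega)
    have h3 : d.periodResponse e (s + 1) = d.periodResponse e' (s + 1) := by
      simp only [periodResponse]
      exact congrArg₂ _ (by rw [h1]) h2
    exact ⟨h3, key _ h h3⟩

theorem estimate_congr {y y' : ℕ → Y → ℝ} (t : ℕ) (h : ∀ s < t, y s = y' s) :
    d.estimate y t = d.estimate y' t := by
  induction t with
  | zero => rfl
  | succ t ih =>
    simp only [estimate]
    rw [ih fun s hs => h s (by omega), h t (by omega)]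

theorem message_congr {y y' : ℕ → Y → ℝ} (t : ℕ) (h : ∀ s, s + 2 * d.P ≤ t → y s = y' s) :
    d.message y t = d.message y' t := by
  unfold message
  split_ifs with ht
  · rfl
  · rw [h _ (by omega), d.estimate_congr _ fun s hs => h s (by omega)]

theorem observedDisplacement_congr (hM : d.M ≤ d.P) {y y' : ℕ → Y → ℝ} (s : ℕ)
    (h : ∀ t < (s + 2) * d.P, y t = y' t) :
    d.observedDisplacement y s = d.observedDisplacement y' s := by
  have e1 : (s + 2) * d.P = (s + 1) * d.P + d.P := by ring
  have e2 : (s + 1) * d.P = s * d.P + d.P := by ring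
  have h1 : (fun j : Fin d.M => y ((s + 1) * d.P + j)) =
      fun j : Fin d.M => y' ((s + 1) * d.P + j) :=
    funext fun j => h _ (by have := j.2; omega)
  have h2 : (fun j : Fin d.M => y (s * d.P + j)) = fun j : Fin d.M => y' (s * d.P + j) :=
    funext fun j => h _ (by have := j.2; omega)
  unfold observedDisplacement
  rw [h1, h2]

theorem controlResponse_congr {ζ ζ' : ℕ → X → ℝ} (t : ℕ)
    (h : ∀ s, s * d.P < t → ζ s = ζ' s) :
    d.controlResponse ζ t = d.controlResponse ζ' t :=
  trajectory_congr t fun s hs => by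
    rw [h (s / d.P) ((Nat.div_mul_le_self s d.P).trans_lt hs)]

/-- This is why the messages are delayed by two periods: the control response at time `t` involves
periods begun before `t`, and each displacement is known by the end of the following period, hence
by time `t + 2 * P`. -/
theorem uncontrolled_congr (hM : d.M ≤ d.P) {y y' : ℕ → Y → ℝ} (t : ℕ)
    (h : ∀ s ≤ t + 2 * d.P, y s = y' s) : d.uncontrolled y t = d.uncontrolled y' t := by
  unfold uncontrolled
  rw [h t (by omega), d.controlResponse_congr t fun s hs =>
    d.observedDisplacement_congr hM s fun σ hσ => h σ ?_]
  have e1 : (s + 2) * d.P = s * d.P + 2 * d.P := by ring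
  omega

/-- The controller runs the observer's recursion on the same corrections, after resting at zero for
two periods. Correct decoding therefore reproduces the observer's estimate exactly. -/
theorem decodedEstimate_message (y : ℕ → Y → ℝ) (t : ℕ) :
    d.decodedEstimate (d.message y) (t + 2 * d.P) = d.estimate y t := by
  induction t with
  | zero =>
    have : ∀ s ≤ 2 * d.P, d.decodedEstimate (d.message y) s = 0 := by
      intro s hs
      induction s with
      | zero => rfl
      | succ s ih =>
        change d.F *ᵥ d.decodedEstimate (d.message y) s + (if s < 2 * d.P then 0 else _) = 0
        rw [ih (by omega), if_pos (by omega)]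
        simp
    exact this _ (by omega)
  | succ t ih =>
    rw [show t + 1 + 2 * d.P = (t + 2 * d.P) + 1 by ring]
    change d.F *ᵥ d.decodedEstimate (d.message y) (t + 2 * d.P) +
      (if t + 2 * d.P < 2 * d.P then 0 else d.dec (d.message y (t + 2 * d.P))) = _
    rw [ih, if_neg (by omega)]
    simp [message, estimate]

/-! ### Measurability of the observer -/

section Measurability

theorem measurable_dec_enc : Measurable fun y => d.dec (d.enc y) := by
  intro S _
  have : (fun y => d.dec (d.enc y)) ⁻¹' S = ⋃ m ∈ d.dec ⁻¹' S, {y | d.enc y = m} := by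
    ext y; simp
  rw [this]
  exact MeasurableSet.biUnion (Set.to_countable _) fun m _ => d.measurable_enc m

variable {Ω : Type*} [MeasurableSpace Ω]

theorem measurable_linearMap {ι : Type*} [Finite ι] (L : (ι → Y → ℝ) →ₗ[ℝ] (X → ℝ))
    {f : Ω → ι → Y → ℝ} (hf : Measurable f) : Measurable fun ω => L (f ω) := by
  have := Fintype.ofFinite ι
  exact (LinearMap.toContinuousLinearMap L).continuous.measurable.comp hf

theorem measurable_mulVec {ι κ : Type*} [Fintype κ] [Finite ι] (A : Matrix ι κ ℝ) {f : Ω → κ → ℝ}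
    (hf : Measurable f) : Measurable fun ω => A *ᵥ f ω := by
  have := Fintype.ofFinite ι
  exact (LinearMap.toContinuousLinearMap (Matrix.mulVecLin A)).continuous.measurable.comp hf

theorem measurable_observedDisplacement {y : Ω → ℕ → Y → ℝ} (hy : ∀ t, Measurable fun ω => y ω t)
    (s : ℕ) : Measurable fun ω => d.observedDisplacement (y ω) s :=
  (measurable_latticeRound d.δ).comp
    ((measurable_linearMap d.Λ (measurable_pi_lambda _ fun _ => hy _)).sub
      (measurable_mulVec _ (measurable_linearMap d.Λ (measurable_pi_lambda _ fun _ => hy _))))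

theorem measurable_controlResponse {ζ : Ω → ℕ → X → ℝ} (hζ : ∀ s, Measurable fun ω => ζ ω s)
    (t : ℕ) : Measurable fun ω => d.controlResponse (ζ ω) t := by
  induction t with
  | zero => exact measurable_const
  | succ t ih =>
    exact (measurable_mulVec d.F ih).add (measurable_mulVec d.G
      ((LinearMap.toContinuousLinearMap (d.K (t % d.P))).continuous.measurable.comp (hζ _)))

theorem measurable_uncontrolled {y : Ω → ℕ → Y → ℝ} (hy : ∀ t, Measurable fun ω => y ω t)
    (t : ℕ) : Measurable fun ω => d.uncontrolled (y ω) t :=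
  (hy t).sub (measurable_mulVec d.H (d.measurable_controlResponse
    (fun s => d.measurable_observedDisplacement hy s) t))

theorem measurable_estimate {y : Ω → ℕ → Y → ℝ} (hy : ∀ t, Measurable fun ω => y ω t)
    (t : ℕ) : Measurable fun ω => d.estimate (y ω) t := by
  induction t with
  | zero => exact measurable_const
  | succ t ih =>
    exact (measurable_mulVec d.F ih).add
      (d.measurable_dec_enc.comp ((hy t).sub (measurable_mulVec d.H ih)))

theorem measurableSet_message {y : Ω → ℕ → Y → ℝ} (hy : ∀ t, Measurable fun ω => y ω t)
    (t : ℕ) (m : Fin k → ZMod 2) : MeasurableSet {ω | d.message (y ω) t = m} := by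
  unfold message
  split_ifs
  · exact MeasurableSet.const _
  · exact ((hy _).sub (measurable_mulVec d.H (d.measurable_estimate hy _))) (d.measurable_enc m)

end Measurability

/-- Measurements up to time `t`, continued by zeros. -/
def extendMeasurements (t : ℕ) (y : Fin (t + 1) → Y → ℝ) (s : ℕ) : Y → ℝ :=
  if h : s < t + 1 then y ⟨s, h⟩ else 0

/-- Estimates made before time `t`, continued by zeros. -/
def extendEstimates (t : ℕ) (e : (s : Fin t) → Fin (s + 1) → Fin k → ZMod 2) (s τ : ℕ) :
    Fin k → ZMod 2 :=
  if h : s < t then (if h' : τ < s + 1 then e ⟨s, h⟩ ⟨τ, h'⟩ else 0) else 0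

theorem measurable_extendMeasurements (t s : ℕ) :
    Measurable fun y : Fin (t + 1) → Y → ℝ => extendMeasurements t y s := by
  unfold extendMeasurements
  split_ifs
  · exact measurable_pi_apply _
  · exact measurable_const

/-- The observer and the controller. -/
noncomputable def scheme : Scheme Y U k where
  observer t y := d.message (d.uncontrolled (extendMeasurements t y)) t
  measurable_observer t m := d.measurableSet_message
    (fun s => d.measurable_uncontrolled (fun σ => measurable_extendMeasurements t σ) s) t m
  controller t e := d.K (t % d.P) (d.displacements (extendEstimates t e) (t / d.P))

/-- The continuation by zeros is never seen, because the delay makes the message at time `t` depend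
on measurements up to time `t` only. -/
theorem scheme_observer (hM : d.M ≤ d.P) (y : ℕ → Y → ℝ) (t : ℕ) :
    d.scheme.observer t (fun s => y s) = d.message (d.uncontrolled y) t := by
  refine d.message_congr t fun s hs => d.uncontrolled_congr hM s fun σ hσ => ?_
  simp [extendMeasurements, show σ < t + 1 by omega]

/-- The error in the displacement of period `s`, before rounding, that is caused by the noises. -/
def disturbance (w : ℕ → X → ℝ) (v : ℕ → Y → ℝ) (s : ℕ) : X → ℝ :=
  d.Λ (fun j => d.H *ᵥ inputResponse d.F w ((s + 1) * d.P) j + v ((s + 1) * d.P + j)) -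
    (d.F ^ d.P) *ᵥ d.Λ (fun j => d.H *ᵥ inputResponse d.F w (s * d.P) j + v (s * d.P + j)) +
    inputResponse d.F w (s * d.P) d.P

/-- What the parameters of a design have to satisfy, for noises and an initial state bounded by
`w'`, `v'` and `z'`: the first `M` steps of a period are idle, the controls of a period do produce
their displacement, states are recovered from measurements, displacements are recovered
in spite of the noises, the estimates of the state of the uncontrolled plant have an error of at
most `ε`, and the powers of `F` grow like those of `r`. -/
structure IsSuitable (w' v' z' ε C r : ℝ) : Prop where
  M_lt : d.M < d.P
  idle : ∀ j < d.M, d.K j = 0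
  displace : ∀ ζ, ∑ j ∈ Finset.range d.P, (d.F ^ (d.P - 1 - j)) *ᵥ (d.G *ᵥ d.K j ζ) = ζ
  recover : ∀ x, d.Λ (fun j => d.H *ᵥ ((d.F ^ (j : ℕ)) *ᵥ x)) = x
  mesh_pos : 0 < d.δ
  disturbance_lt : ∀ (w : ℕ → X → ℝ) (v : ℕ → Y → ℝ), (∀ t, ‖w t‖ ≤ w') → (∀ t, ‖v t‖ ≤ v') → ∀ s,
    2 * ‖d.disturbance w v s‖ < d.δ
  estimate_error : ∀ (x₀ : X → ℝ) (w : ℕ → X → ℝ) (v : ℕ → Y → ℝ), ‖x₀‖ ≤ z' →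
    (∀ t, ‖w t‖ ≤ w') → (∀ t, ‖v t‖ ≤ v') → ∀ t,
    ‖trajectory d.F x₀ w t -
      d.estimate (fun s => d.H *ᵥ trajectory d.F x₀ w s + v s) t‖ ≤ ε
  growth_nonneg : 0 ≤ C
  one_lt : 1 < r
  growth : ∀ (j : ℕ) (v : X → ℝ), ‖(d.F ^ j) *ᵥ v‖ ≤ C * r ^ j * ‖v‖

variable {d} {w' v' z' ε C r : ℝ}

/-! ### Exact recovery of the displacements -/

section Inputs

variable {ζ : ℕ → X → ℝ} {w : ℕ → X → ℝ} {v : ℕ → Y → ℝ} {x : ℕ → X → ℝ}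

theorem inputResponse_controls_period (hd : d.IsSuitable w' v' z' ε C r) (ζ : ℕ → X → ℝ) (s : ℕ) :
    inputResponse d.F (fun t => d.G *ᵥ d.K (t % d.P) (ζ (t / d.P))) (s * d.P) d.P = ζ s := by
  rw [← hd.displace (ζ s)]
  refine Finset.sum_congr rfl fun j hj => ?_
  have hj := Finset.mem_range.1 hj
  have h1 : (s * d.P + j) % d.P = j := by
    rw [mul_comm, Nat.mul_add_mod, Nat.mod_eq_of_lt hj]
  have h2 : (s * d.P + j) / d.P = s := by
    rw [mul_comm, Nat.mul_add_div (by omega), Nat.div_eq_of_lt hj, add_zero]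
  simp only [h1, h2]

theorem inputResponse_controls_idle (hd : d.IsSuitable w' v' z' ε C r) (ζ : ℕ → X → ℝ) (s : ℕ)
    {j : ℕ} (hj : j ≤ d.M) :
    inputResponse d.F (fun t => d.G *ᵥ d.K (t % d.P) (ζ (t / d.P))) (s * d.P) j = 0 := by
  refine Finset.sum_eq_zero fun i hi => ?_
  have hi := Finset.mem_range.1 hi
  have hM := hd.M_lt
  have h1 : (s * d.P + i) % d.P = i := by
    rw [mul_comm, Nat.mul_add_mod, Nat.mod_eq_of_lt (by omega)]
  simp only [h1, hd.idle i (by omega), LinearMap.zero_apply, Matrix.mulVec_zero]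

theorem state_next_period (hd : d.IsSuitable w' v' z' ε C r)
    (hx : ∀ t, x (t + 1) = d.F *ᵥ x t + (d.G *ᵥ d.K (t % d.P) (ζ (t / d.P)) + w t)) (s : ℕ) :
    x ((s + 1) * d.P) = (d.F ^ d.P) *ᵥ x (s * d.P) + ζ s + inputResponse d.F w (s * d.P) d.P := by
  rw [add_mul, one_mul, state_add_eq hx, inputResponse_add, inputResponse_controls_period hd,
    add_assoc]

/-- No control acts before the `M` measurements are complete, so `Λ` sees a free evolution plus the
noises. -/
theorem measurement_idle (hd : d.IsSuitable w' v' z' ε C r)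
    (hx : ∀ t, x (t + 1) = d.F *ᵥ x t + (d.G *ᵥ d.K (t % d.P) (ζ (t / d.P)) + w t)) (s : ℕ) :
    d.Λ (fun j => d.H *ᵥ x (s * d.P + j) + v (s * d.P + j)) = x (s * d.P) +
      d.Λ (fun j => d.H *ᵥ inputResponse d.F w (s * d.P) j + v (s * d.P + j)) := by
  conv_rhs => rw [← hd.recover (x (s * d.P))]
  rw [← map_add]
  congr 1
  funext j
  rw [state_add_eq hx, inputResponse_add, inputResponse_controls_idle hd ζ s j.2.le, zero_add,
    Matrix.mulVec_add]
  simp [add_assoc]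

/-- The observer knows the displacements exactly, whatever the controller does. -/
theorem observedDisplacement_eq (hd : d.IsSuitable w' v' z' ε C r)
    (hw : ∀ t, ‖w t‖ ≤ w') (hv : ∀ t, ‖v t‖ ≤ v')
    (hx : ∀ t, x (t + 1) = d.F *ᵥ x t + (d.G *ᵥ d.K (t % d.P) (ζ (t / d.P)) + w t))
    (hζ : ∀ s, ∃ p, ζ s = latticeRound d.δ p) (s : ℕ) :
    d.observedDisplacement (fun t => d.H *ᵥ x t + v t) s = ζ s := by
  obtain ⟨p, hp⟩ := hζ s
  unfold observedDisplacement
  rw [measurement_idle hd hx, measurement_idle hd hx, state_next_period hd hx, hp]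
  -- The two terms with `F ^ P` applied to the state cancel. The lattice point `ζ s` plus
  -- `disturbance` is left, and the latter is below half the mesh.
  refine Eq.trans ?_
    (latticeRound_add_of_norm_lt hd.mesh_pos p _ (hd.disturbance_lt w v hw hv s))
  congr 1
  unfold disturbance
  rw [Matrix.mulVec_add]
  abel

theorem state_eq_add_controlResponse
    (hx : ∀ t, x (t + 1) = d.F *ᵥ x t + (d.G *ᵥ d.K (t % d.P) (ζ (t / d.P)) + w t)) (t : ℕ) :
    x t = trajectory d.F (x 0) w t + d.controlResponse ζ t := by
  rw [eq_trajectory hx t, controlResponse, add_comm, ← trajectory_add, zero_add]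

/-- By linearity the state is the uncontrolled trajectory plus the control response, and exact
knowledge of the displacements removes the second summand without error. -/
theorem uncontrolled_eq (hd : d.IsSuitable w' v' z' ε C r)
    (hw : ∀ t, ‖w t‖ ≤ w') (hv : ∀ t, ‖v t‖ ≤ v')
    (hx : ∀ t, x (t + 1) = d.F *ᵥ x t + (d.G *ᵥ d.K (t % d.P) (ζ (t / d.P)) + w t))
    (hζ : ∀ s, ∃ p, ζ s = latticeRound d.δ p) :
    d.uncontrolled (fun t => d.H *ᵥ x t + v t) =
      fun t => d.H *ᵥ trajectory d.F (x 0) w t + v t := by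
  funext t
  have h : d.observedDisplacement (fun t => d.H *ᵥ x t + v t) = ζ :=
    funext fun s => observedDisplacement_eq hd hw hv hx hζ s
  unfold uncontrolled
  rw [h]
  beta_reduce
  rw [state_eq_add_controlResponse hx t, Matrix.mulVec_add]
  abel

end Inputs

theorem controlResponse_period (hd : d.IsSuitable w' v' z' ε C r)
    (e : ℕ → ℕ → Fin k → ZMod 2) (s : ℕ) :
    d.controlResponse (d.displacements e) (s * d.P) = d.periodResponse e s := by
  induction s with
  | zero => simp [controlResponse, trajectory, periodResponse]
  | succ s ih =>
    have hx : ∀ t, d.controlResponse (d.displacements e) (t + 1) =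
        d.F *ᵥ d.controlResponse (d.displacements e) t +
          (d.G *ᵥ d.K (t % d.P) (d.displacements e (t / d.P)) + (0 : ℕ → X → ℝ) t) := by
      intro t
      simp [controlResponse, trajectory]
    rw [state_next_period hd hx, ih]
    simp [periodResponse, inputResponse, displacements]

theorem exists_displacements_eq (e : ℕ → ℕ → Fin k → ZMod 2) (s : ℕ) :
    ∃ p, d.displacements e s = latticeRound d.δ p := ⟨_, rfl⟩

/-- Estimates `e s τ`, continued by zeros to `τ > s`. -/
def totalEstimates (e : (s : ℕ) → Fin (s + 1) → Fin k → ZMod 2) (s τ : ℕ) : Fin k → ZMod 2 :=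
  if h : τ < s + 1 then e s ⟨τ, h⟩ else 0

theorem scheme_controller (e : (s : ℕ) → Fin (s + 1) → Fin k → ZMod 2) (t : ℕ) :
    d.scheme.controller t (fun s => e s) =
      d.K (t % d.P) (d.displacements (totalEstimates e) (t / d.P)) := by
  change d.K (t % d.P) (d.displacements _ (t / d.P)) = _
  congr 1
  refine (d.periodResponse_congr _ fun σ hσ τ hτ => ?_).2
  have := Nat.div_mul_le_self t d.P
  simp [extendEstimates, totalEstimates, show σ < t by omega]

/-- The error caused by wrong decoding is governed by the time since the first wrong message. -/
theorem norm_decodedEstimate_sub_le (hd : d.IsSuitable w' v' z' ε C r) {B : ℝ}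
    (hB : ∀ m, ‖d.dec m‖ ≤ B) {b b' : ℕ → Fin k → ZMod 2} {τ n : ℕ}
    (h : ∀ s < τ, b s = b' s) :
    ‖d.decodedEstimate b (τ + n) - d.decodedEstimate b' (τ + n)‖ ≤
      C * (2 * B) / (r - 1) * r ^ n := by
  have hB0 : 0 ≤ B := (norm_nonneg _).trans (hB 0)
  -- Before time `τ` both recursions agree, so the difference is the response to inputs of norm at
  -- most `2 * B` that start at `τ`.
  unfold decodedEstimate
  rw [state_add_eq (fun _ => rfl) (x := trajectory d.F 0 _) τ n,
    state_add_eq (fun _ => rfl) (x := trajectory d.F 0 fun t =>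
      if t < 2 * d.P then 0 else d.dec (b' t)) τ n,
    trajectory_congr τ (fun s hs => by rw [h s hs]), add_sub_add_left_eq_sub]
  have e : ∀ u u' : ℕ → X → ℝ, inputResponse d.F u τ n - inputResponse d.F u' τ n =
      inputResponse d.F (fun s => u s - u' s) τ n := by
    intro u u'
    simp only [inputResponse, Matrix.mulVec_sub, Finset.sum_sub_distrib]
  rw [e]
  refine norm_inputResponse_le hd.growth_nonneg hd.one_lt hd.growth τ (fun s _ => ?_) n
  split_ifs
  · simpa using hB0
  · refine (norm_sub_le _ _).trans ?_
    linarith [hB (b s), hB (b' s)]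

/-! ### The closed loop -/

section ClosedLoop

variable {n : ℕ} {𝒵 Ξ : Type*} [MeasurableSpace 𝒵] [MeasurableSpace Ξ]

/-- The messages that are sent: they depend on the noises of the plant only. -/
def sentMessages (d : Design X Y U k) (x₀ : X → ℝ) (w : ℕ → X → ℝ) (v : ℕ → Y → ℝ) :
    ℕ → Fin k → ZMod 2 :=
  d.message fun t => d.H *ᵥ trajectory d.F x₀ w t + v t

/-- What the decoding errors contribute to the state estimate used in period `s`. -/
noncomputable def decodingError (d : Design X Y U k) (ch : Channel n 𝒵 Ξ) (code : Code n k 𝒵)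
    (b : ℕ → Fin k → ZMod 2) (ξ : Ξ) (s : ℕ) : ℝ :=
  ‖d.decodedEstimate b (s * d.P) -
    d.decodedEstimate (totalEstimates (estimates ch code b ξ) (s * d.P - 1)) (s * d.P)‖

variable {ch : Channel n 𝒵 Ξ} {code : Code n k 𝒵} {x₀ : X → ℝ} {w : ℕ → X → ℝ} {v : ℕ → Y → ℝ}

theorem closedLoop_eq (hd : d.IsSuitable w' v' z' ε C r) (hw : ∀ t, ‖w t‖ ≤ w')
    (hv : ∀ t, ‖v t‖ ≤ v') (ξ : Ξ) (t : ℕ) :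
    closedLoopState d.F d.G d.H ch code d.scheme x₀ w v ξ (t + 1) =
      d.F *ᵥ closedLoopState d.F d.G d.H ch code d.scheme x₀ w v ξ t +
      (d.G *ᵥ d.K (t % d.P) (d.displacements (totalEstimates
        (estimates ch code (d.sentMessages x₀ w v) ξ)) (t / d.P)) + w t) := by
  set x := closedLoopState d.F d.G d.H ch code d.scheme x₀ w v ξ with hxdef
  have hcontrol : ∀ b, (fun r => d.scheme.observer r fun l => d.H *ᵥ x l + v l) = b → ∀ t,
      x (t + 1) = d.F *ᵥ x t + (d.G *ᵥ d.K (t % d.P) (d.displacements (totalEstimates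
        (estimates ch code b ξ)) (t / d.P)) + w t) := by
    rintro b rfl t
    rw [← scheme_controller, ← add_assoc]
    exact closedLoopState_succ d.F d.G d.H ch code d.scheme x₀ w v ξ t
  refine hcontrol _ (funext fun r => ?_) t
  rw [d.scheme_observer hd.M_lt.le (fun l => d.H *ᵥ x l + v l),
    uncontrolled_eq hd hw hv (hcontrol _ rfl) (exists_displacements_eq _)]
  rfl

/-- In period `s + 2` the controller holds an estimate `p'` of the uncontrolled state at the start
of period `s`, and its displacement brings the control response to `-F ^ (3P) p'` up to rounding.
Four errors survive: that of the estimator, three periods of noise, the rounding, and the decoding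
error amplified by `F ^ (3P)`. -/
theorem norm_closedLoopState_period_le (hd : d.IsSuitable w' v' z' ε C r) (hx₀ : ‖x₀‖ ≤ z')
    (hw : ∀ t, ‖w t‖ ≤ w') (hv : ∀ t, ‖v t‖ ≤ v') (ξ : Ξ) (s : ℕ) :
    ‖closedLoopState d.F d.G d.H ch code d.scheme x₀ w v ξ ((s + 3) * d.P)‖ ≤
      C * r ^ (3 * d.P) * ε + C * w' / (r - 1) * r ^ (3 * d.P) + d.δ +
      C * r ^ (3 * d.P) *
        d.decodingError ch code (d.sentMessages x₀ w v) ξ (s + 2) := by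
  set e := totalEstimates (estimates ch code (d.sentMessages x₀ w v) ξ) with he
  have hP3 : (s + 3) * d.P = s * d.P + 3 * d.P := by ring
  have hP2 : (s + 2) * d.P = s * d.P + 2 * d.P := by ring
  set z := trajectory d.F x₀ w with hz
  set p := d.estimate (fun s => d.H *ᵥ trajectory d.F x₀ w s + v s) (s * d.P) with hp
  have hp' : d.decodedEstimate (d.sentMessages x₀ w v) ((s + 2) * d.P) = p := by
    rw [hP2]; exact d.decodedEstimate_message _ _
  set p' := d.decodedEstimate (e ((s + 2) * d.P - 1)) ((s + 2) * d.P) with hp''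
  have h1 := state_eq_add_controlResponse (closedLoop_eq (ch := ch) (code := code) (x₀ := x₀)
    hd hw hv ξ) ((s + 3) * d.P)
  rw [controlResponse_period hd] at h1
  set c := d.periodResponse e (s + 2)
  have h2 : d.periodResponse e (s + 3) = -((d.F ^ (3 * d.P)) *ᵥ p') +
      (latticeRound d.δ (-((d.F ^ d.P) *ᵥ (c + (d.F ^ (2 * d.P)) *ᵥ p'))) -
        -((d.F ^ d.P) *ᵥ (c + (d.F ^ (2 * d.P)) *ᵥ p'))) := by
    change (d.F ^ d.P) *ᵥ c + latticeRound d.δ (-((d.F ^ d.P) *ᵥ (c + (d.F ^ (2 * d.P)) *ᵥ p')))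
      = _
    rw [show 3 * d.P = d.P + 2 * d.P by ring, pow_add, ← Matrix.mulVec_mulVec]
    generalize latticeRound d.δ (-((d.F ^ d.P) *ᵥ (c + (d.F ^ (2 * d.P)) *ᵥ p'))) = R
    rw [Matrix.mulVec_add]
    abel
  have h3 : z ((s + 3) * d.P) = (d.F ^ (3 * d.P)) *ᵥ z (s * d.P) +
      inputResponse d.F w (s * d.P) (3 * d.P) := by
    rw [hP3]
    exact state_add_eq (fun _ => rfl) _ _
  have h4 : closedLoopState d.F d.G d.H ch code d.scheme x₀ w v ξ ((s + 3) * d.P) =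
      (d.F ^ (3 * d.P)) *ᵥ (z (s * d.P) - p) + inputResponse d.F w (s * d.P) (3 * d.P) +
      (latticeRound d.δ (-((d.F ^ d.P) *ᵥ (c + (d.F ^ (2 * d.P)) *ᵥ p'))) -
        -((d.F ^ d.P) *ᵥ (c + (d.F ^ (2 * d.P)) *ᵥ p'))) +
      (d.F ^ (3 * d.P)) *ᵥ (p - p') := by
    rw [h1, h2, Matrix.mulVec_sub, Matrix.mulVec_sub]
    change z ((s + 3) * d.P) + _ = _
    rw [h3]
    abel
  have hC := hd.growth_nonneg
  have hr := hd.one_lt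
  rw [h4]
  refine (norm_add_le _ _).trans (add_le_add ((norm_add_le _ _).trans (add_le_add
    ((norm_add_le _ _).trans (add_le_add ?_ ?_)) ?_)) ?_)
  · refine (hd.growth _ _).trans ?_
    gcongr
    exact hd.estimate_error x₀ w v hx₀ hw hv _
  · exact norm_inputResponse_le hC hr hd.growth _ (fun s _ => hw s) _
  · exact norm_latticeRound_sub_le hd.mesh_pos _
  · refine (hd.growth _ _).trans (le_of_eq ?_)
    unfold decodingError
    rw [hp']

/-- The state is bounded by the decoding errors in the estimates that have been used in the
current and in the previous period. -/
theorem exists_norm_closedLoopState_le (hd : d.IsSuitable w' v' z' ε C r) :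
    ∃ A B : ℝ, 0 ≤ A ∧ 0 ≤ B ∧ ∀ (ch : Channel n 𝒵 Ξ) (code : Code n k 𝒵) (x₀ : X → ℝ)
      (w : ℕ → X → ℝ) (v : ℕ → Y → ℝ), ‖x₀‖ ≤ z' → (∀ t, ‖w t‖ ≤ w') → (∀ t, ‖v t‖ ≤ v') →
      ∀ (ξ : Ξ) (s j : ℕ), j < d.P →
      ‖closedLoopState d.F d.G d.H ch code d.scheme x₀ w v ξ ((s + 3) * d.P + j)‖ ≤
        A + B * (d.decodingError ch code (d.sentMessages x₀ w v) ξ (s + 2) +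
          d.decodingError ch code (d.sentMessages x₀ w v) ξ (s + 3)) := by
  obtain ⟨g, hg0, hg⟩ := exists_norm_mulVec_le d.G
  choose κ hκ0 hκ using fun j => exists_norm_linearMap_le (d.K j)
  have hC := hd.growth_nonneg
  have hr := hd.one_lt
  have hr0 : 0 ≤ r := by linarith
  have hr1 : 0 < r - 1 := by linarith
  set κ' := ∑ j ∈ Finset.range d.P, κ j with hκ'
  have hκ'0 : 0 ≤ κ' := Finset.sum_nonneg fun j _ => hκ0 j
  set N := C * w' / (r - 1) with hN
  set A₁ := C * r ^ (3 * d.P) * ε + N * r ^ (3 * d.P) + d.δ with hA₁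
  set B₁ := C * r ^ (3 * d.P) with hB₁
  have hB₁0 : 0 ≤ B₁ := by positivity
  set S := C / (r - 1) * r ^ d.P * (g * κ') with hS
  have hS0 : 0 ≤ S := by positivity
  set D := C * r ^ d.P with hD
  have hD0 : 0 ≤ D := by positivity
  -- the state within a period in terms of the states at its ends
  have hper : ∀ (ch : Channel n 𝒵 Ξ) (code : Code n k 𝒵) (x₀ : X → ℝ)
      (w : ℕ → X → ℝ) (v : ℕ → Y → ℝ), (∀ t, ‖w t‖ ≤ w') → (∀ t, ‖v t‖ ≤ v') →
      ∀ (ξ : Ξ) (s j : ℕ), j < d.P → ∀ a b : ℝ,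
      ‖closedLoopState d.F d.G d.H ch code d.scheme x₀ w v ξ (s * d.P)‖ ≤ a →
      ‖closedLoopState d.F d.G d.H ch code d.scheme x₀ w v ξ ((s + 1) * d.P)‖ ≤ b →
      ‖closedLoopState d.F d.G d.H ch code d.scheme x₀ w v ξ (s * d.P + j)‖ ≤
        D * a + N * r ^ d.P + S * (b + D * a + N * r ^ d.P) := by
    intro ch code x₀ w v hw hv ξ s j hj a b ha hb
    have hx := closedLoop_eq (ch := ch) (code := code) (x₀ := x₀) hd hw hv ξ
    have hw0 : 0 ≤ w' := (norm_nonneg _).trans (hw 0)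
    have hN0 : 0 ≤ N := by positivity
    have ha0 : 0 ≤ a := (norm_nonneg _).trans ha
    set ζ := d.displacements (totalEstimates
      (estimates ch code (d.sentMessages x₀ w v) ξ)) with hζ
    set x := closedLoopState d.F d.G d.H ch code d.scheme x₀ w v ξ with hxd
    have hpow : ∀ i ≤ d.P, r ^ i ≤ r ^ d.P := fun i hi => pow_le_pow_right₀ hr.le hi
    -- The controls within a period are bounded through the states at its two ends, which determine
    -- the displacement.
    have hζs : ‖ζ s‖ ≤ b + D * a + N * r ^ d.P := by
      have h1 := state_next_period hd hx s
      have h2 : ζ s = x ((s + 1) * d.P) - (d.F ^ d.P) *ᵥ x (s * d.P) -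
          inputResponse d.F w (s * d.P) d.P := by
        rw [h1]; abel
      rw [h2]
      refine (norm_sub_le _ _).trans (add_le_add ((norm_sub_le _ _).trans
        (add_le_add hb ?_)) ?_)
      · exact (hd.growth _ _).trans (by gcongr)
      · exact norm_inputResponse_le hC hr hd.growth _ (fun s _ => hw s) _
    rw [state_add_eq hx, inputResponse_add]
    have h1 : ‖(d.F ^ j) *ᵥ x (s * d.P)‖ ≤ D * a :=
      (hd.growth _ _).trans (by
        rw [hD]
        have := hpow j hj.le
        gcongr ?_ * ?_
        exact mul_le_mul_of_nonneg_left this hC)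
    have h2 : ‖inputResponse d.F w (s * d.P) j‖ ≤ N * r ^ d.P :=
      (norm_inputResponse_le hC hr hd.growth _ (fun s _ => hw s) _).trans
        (mul_le_mul_of_nonneg_left (hpow j hj.le) hN0)
    have h3 : ‖inputResponse d.F (fun t => d.G *ᵥ d.K (t % d.P) (ζ (t / d.P))) (s * d.P) j‖ ≤
        S * (b + D * a + N * r ^ d.P) := by
      -- Freezing the displacement at `ζ s` gives inputs bounded at all later times, as
      -- `norm_inputResponse_le` requires.
      have hcut : inputResponse d.F (fun t => d.G *ᵥ d.K (t % d.P) (ζ (t / d.P))) (s * d.P) j =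
          inputResponse d.F (fun t => d.G *ᵥ d.K (t % d.P) (ζ s)) (s * d.P) j := by
        refine Finset.sum_congr rfl fun i hi => ?_
        have hi := Finset.mem_range.1 hi
        have h2 : (s * d.P + i) / d.P = s := by
          rw [mul_comm, Nat.mul_add_div (by omega), Nat.div_eq_of_lt (by omega), add_zero]
        simp only [h2]
      rw [hcut]
      have hu : ∀ t, ‖d.G *ᵥ d.K (t % d.P) (ζ s)‖ ≤ g * (κ' * ‖ζ s‖) := by
        intro t
        refine (hg _).trans ?_
        gcongr
        refine (hκ _ _).trans ?_
        gcongr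
        exact Finset.single_le_sum (f := κ) (fun i _ => hκ0 i)
          (Finset.mem_range.2 (Nat.mod_lt _ (by omega)))
      refine (norm_inputResponse_le hC hr hd.growth _ (fun t _ => hu t) _).trans ?_
      calc C * (g * (κ' * ‖ζ s‖)) / (r - 1) * r ^ j
          ≤ C * (g * (κ' * (b + D * a + N * r ^ d.P))) / (r - 1) * r ^ d.P := by
            have h0 := (norm_nonneg _).trans hζs
            refine mul_le_mul ?_ (hpow j hj.le) (by positivity) (by positivity)
            gcongr
        _ = _ := by rw [hS]; ring
    refine (norm_add_le _ _).trans ?_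
    refine (add_le_add h1 ((norm_add_le _ _).trans (add_le_add h3 h2))).trans (le_of_eq ?_)
    ring
  -- The signs of `w'` and `ε` are not known here, whence the absolute value.
  refine ⟨|D * A₁ + N * r ^ d.P + S * (A₁ + D * A₁ + N * r ^ d.P)|,
    D * B₁ + S * (B₁ + D * B₁), abs_nonneg _, by positivity,
    fun ch code x₀ w v hx₀ hw hv ξ s j hj => ?_⟩
  have h1 := norm_closedLoopState_period_le (ch := ch) (code := code) hd hx₀ hw hv ξ s
  have h2 := norm_closedLoopState_period_le (ch := ch) (code := code) hd hx₀ hw hv ξ (s + 1)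
  refine (hper ch code x₀ w v hw hv ξ (s + 3) j hj _ _ h1 h2).trans ?_
  have e1 : 0 ≤ d.decodingError ch code (d.sentMessages x₀ w v) ξ (s + 2) := norm_nonneg _
  have e2 : 0 ≤ d.decodingError ch code (d.sentMessages x₀ w v) ξ (s + 3) := norm_nonneg _
  rw [show s + 1 + 2 = s + 3 by ring]
  generalize d.decodingError ch code (d.sentMessages x₀ w v) ξ (s + 2) = E2 at *
  generalize d.decodingError ch code (d.sentMessages x₀ w v) ξ (s + 3) = E3 at *
  have h3 := le_abs_self (D * A₁ + N * r ^ d.P + S * (A₁ + D * A₁ + N * r ^ d.P))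
  have e3 : 0 ≤ D * B₁ * E3 := by positivity
  have e4 : 0 ≤ S * (B₁ * E2) := by positivity
  have e5 : 0 ≤ S * (D * B₁ * E3) := by positivity
  linarith

end ClosedLoop

end Design

/-! ### Events of the channel -/

section Channel

variable {n k : ℕ} {𝒵 Ξ : Type*} [MeasurableSpace 𝒵] [MeasurableSpace Ξ]

theorem measurableSet_estimates (ch : Channel n 𝒵 Ξ) (code : Code n k 𝒵)
    (b : ℕ → Fin k → ZMod 2) (t : ℕ) (σ : Fin (t + 1)) (m : Fin k → ZMod 2) :
    MeasurableSet {ξ | estimates ch code b ξ t σ = m} := by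
  have h : Measurable fun ξ => fun s : Fin (t + 1) =>
      ch.out s (fun r => code.enc r fun l => b l) ξ :=
    measurable_pi_lambda _ fun s => ch.measurable_out s _
  exact h (code.measurable_dec t σ m)

theorem measurable_comp_estimates (ch : Channel n 𝒵 Ξ) (code : Code n k 𝒵)
    (b : ℕ → Fin k → ZMod 2) (t : ℕ) (f : (Fin (t + 1) → Fin k → ZMod 2) → ℝ) :
    Measurable fun ξ => f (estimates ch code b ξ t) := by
  intro S _
  have : (fun ξ => f (estimates ch code b ξ t)) ⁻¹' S =
      ⋃ m ∈ f ⁻¹' S, ⋂ σ, {ξ | estimates ch code b ξ t σ = m σ} := by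
    ext ξ
    simp [← funext_iff]
  rw [this]
  exact MeasurableSet.biUnion (Set.to_countable _) fun m _ =>
    MeasurableSet.iInter fun σ => measurableSet_estimates ch code b t σ _

theorem measurableSet_firstErrorAt (ch : Channel n 𝒵 Ξ) (code : Code n k 𝒵)
    (b : ℕ → Fin k → ZMod 2) (t : ℕ) (τ : Fin (t + 1)) :
    MeasurableSet (firstErrorAt ch code b t τ) := by
  have h := measurableSet_estimates ch code b t
  have e : firstErrorAt ch code b t τ = {ξ | estimates ch code b ξ t τ = b τ}ᶜ ∩
      ⋂ σ, ⋂ _ : σ < τ, {ξ | estimates ch code b ξ t σ = b σ} := by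
    ext ξ
    simp [firstErrorAt]
  rw [e]
  exact (h τ (b τ)).compl.inter
    (MeasurableSet.iInter fun σ => MeasurableSet.iInter fun _ => h σ (b σ))

/-- In an anytime reliable code the exponential bound holds for all delays, with another
constant. -/
theorem IsAnytimeReliable.exists_bound {ch : Channel n 𝒵 Ξ} {code : Code n k 𝒵} {R β : ℝ}
    (h : IsAnytimeReliable ch code R β) (hβ : (2 : ℝ) ^ (-(n * β)) ≤ 1) :
    ∃ (d₀ : ℕ) (η : ℝ), 0 ≤ η ∧ ∀ (b : ℕ → Fin k → ZMod 2) (t : ℕ) (τ : Fin (t + 1)),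
      d₀ ≤ t → ch.law (firstErrorAt ch code b t τ) ≤
        ENNReal.ofReal (η * ((2 : ℝ) ^ (-(n * β))) ^ (t + 1 - (τ : ℕ))) := by
  obtain ⟨d₀, -, -, η, hη⟩ := h
  set θ := (2 : ℝ) ^ (-(n * β)) with hθ
  have hθ0 : 0 < θ := by positivity
  have := ch.isProb
  -- For delays below `d₀` the second summand makes the bound at least `1`, which is trivial for a
  -- probability.
  refine ⟨d₀, |η| + 1 / θ ^ d₀, by positivity, fun b t τ ht => ?_⟩
  have hτ := τ.2
  rcases le_or_gt d₀ (t + 1 - (τ : ℕ)) with hd | hd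
  · refine (hη b t (t + 1 - (τ : ℕ)) τ ht hd (by omega)).trans (ENNReal.ofReal_le_ofReal ?_)
    have e : (2 : ℝ) ^ (-(n * β * (t + 1 - (τ : ℕ) : ℕ))) = θ ^ (t + 1 - (τ : ℕ)) := by
      rw [hθ, ← Real.rpow_mul_natCast (by norm_num)]
      congr 1
      ring
    rw [e]
    gcongr
    have h1 := le_abs_self η
    have h2 : 0 ≤ 1 / θ ^ d₀ := by positivity
    linarith
  · refine prob_le_one.trans ?_
    rw [← ENNReal.ofReal_one]
    refine ENNReal.ofReal_le_ofReal ?_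
    have h1 : θ ^ d₀ ≤ θ ^ (t + 1 - (τ : ℕ)) := pow_le_pow_of_le_one hθ0.le hβ hd.le
    calc (1 : ℝ) = 1 / θ ^ d₀ * θ ^ d₀ := by field_simp
      _ ≤ (|η| + 1 / θ ^ d₀) * θ ^ (t + 1 - (τ : ℕ)) := by
        gcongr
        have := abs_nonneg η
        linarith

end Channel

/-! ### Mean squared decoding error and stability -/

namespace Design

variable {X Y U : Type*} [Fintype X] [Fintype Y] [Fintype U] [DecidableEq X] {k : ℕ}
  {d : Design X Y U k} {w' v' z' ε C r : ℝ}
  {n : ℕ} {𝒵 Ξ : Type*} [MeasurableSpace 𝒵] [MeasurableSpace Ξ]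
  {ch : Channel n 𝒵 Ξ} {code : Code n k 𝒵} {R β : ℝ}

/-- The decoding error in terms of the time of the first wrong message. -/
theorem ofReal_sq_decodingError_le (hd : d.IsSuitable w' v' z' ε C r) {B : ℝ}
    (hB : ∀ m, ‖d.dec m‖ ≤ B) (b : ℕ → Fin k → ZMod 2) (ξ : Ξ) {s t : ℕ}
    (hst : s * d.P = t + 1) :
    ENNReal.ofReal (d.decodingError ch code b ξ s ^ 2) ≤
      ∑ τ : Fin (t + 1), (firstErrorAt ch code b t τ).indicator (fun _ => ENNReal.ofReal
        ((C * (2 * B) / (r - 1) * r ^ (t + 1 - (τ : ℕ))) ^ 2)) ξ := by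
  have hst' : s * d.P - 1 = t := by omega
  by_cases h : ∃ τ, ξ ∈ firstErrorAt ch code b t τ
  · obtain ⟨τ, hτ⟩ := h
    refine le_trans ?_ (Finset.single_le_sum (fun _ _ => zero_le) (Finset.mem_univ τ))
    rw [Set.indicator_of_mem hτ]
    refine ENNReal.ofReal_le_ofReal (pow_le_pow_left₀ (norm_nonneg (_ - _)) ?_ 2)
    have hτt : s * d.P = (τ : ℕ) + (t + 1 - τ) := by omega
    rw [hst', hτt]
    refine norm_decodedEstimate_sub_le hd hB fun σ hσ => ?_
    have h1 := hτ.2 ⟨σ, by omega⟩ hσ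
    simp only [totalEstimates, show σ < t + 1 by omega, dif_pos]
    exact h1.symm
  -- Without a first error there is no error at all, by strong induction, and the decoding error
  -- vanishes.
  · have hall : ∀ σ : ℕ, ∀ hσ : σ < t + 1, estimates ch code b ξ t ⟨σ, hσ⟩ = b σ := by
      intro σ
      induction σ using Nat.strong_induction_on with
      | _ σ ih =>
        intro hσ
        by_contra hne
        exact h ⟨⟨σ, hσ⟩, hne, fun ρ hρ => ih ρ hρ ρ.2⟩
    have : d.decodingError ch code b ξ s = 0 := by
      unfold decodingError
      rw [hst', hst, d.decodedEstimate_congr (b := b) (t + 1) (fun σ hσ => ?_), sub_self,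
        norm_zero]
      simp [totalEstimates, hσ, hall]
    simp [this]

theorem measurable_decodingError (d : Design X Y U k) (ch : Channel n 𝒵 Ξ) (code : Code n k 𝒵)
    (b : ℕ → Fin k → ZMod 2) (s : ℕ) :
    Measurable fun ξ => d.decodingError ch code b ξ s ^ 2 :=
  measurable_comp_estimates ch code b (s * d.P - 1) fun e => ‖d.decodedEstimate b (s * d.P) -
    d.decodedEstimate (fun τ => if h : τ < s * d.P - 1 + 1 then e ⟨τ, h⟩ else 0) (s * d.P)‖ ^ 2

/-- The mean squared decoding error is bounded uniformly in time and in the messages. -/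
theorem exists_lintegral_sq_decodingError_le (hd : d.IsSuitable w' v' z' ε C r)
    (hcode : IsAnytimeReliable ch code R β) (hrβ : (2 : ℝ) ^ (-(n * β)) * r ^ 2 < 1) :
    ∃ (s₀ : ℕ) (K : ℝ), ∀ (b : ℕ → Fin k → ZMod 2) (s : ℕ), s₀ ≤ s →
      ∫⁻ ξ, ENNReal.ofReal (d.decodingError ch code b ξ s ^ 2) ∂ch.law ≤ ENNReal.ofReal K := by
  set θ := (2 : ℝ) ^ (-(n * β)) with hθ
  have hθ0 : 0 < θ := by positivity
  have hr := hd.one_lt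
  have hθ1 : θ ≤ 1 := by nlinarith
  obtain ⟨d₀, η, hη0, hη⟩ := hcode.exists_bound hθ1
  obtain ⟨B, hB⟩ : ∃ B, ∀ m, ‖d.dec m‖ ≤ B :=
    ⟨∑ m, ‖d.dec m‖, fun m => Finset.single_le_sum (f := fun m => ‖d.dec m‖)
      (fun _ _ => norm_nonneg _) (Finset.mem_univ m)⟩
  set c := C * (2 * B) / (r - 1) with hc
  set q := θ * r ^ 2 with hq
  have hq0 : 0 < q := by positivity
  -- The estimates in use are made at `t = s * P - 1`, which has to be at least `d₀`. The constant
  -- sums the squared growth times the error probability as a geometric series in `q`.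
  refine ⟨d₀ + 1, c ^ 2 * η * (1 / (1 - q)), fun b s hs => ?_⟩
  have hP : 1 ≤ d.P := by have := hd.M_lt; omega
  have hsP : d₀ + 1 ≤ s * d.P := hs.trans (Nat.le_mul_of_pos_right s hP)
  obtain ⟨t, ht⟩ : ∃ t, s * d.P = t + 1 := ⟨s * d.P - 1, by omega⟩
  calc ∫⁻ ξ, ENNReal.ofReal (d.decodingError ch code b ξ s ^ 2) ∂ch.law
      ≤ ∫⁻ ξ, ∑ τ : Fin (t + 1), (firstErrorAt ch code b t τ).indicator (fun _ =>
          ENNReal.ofReal ((c * r ^ (t + 1 - (τ : ℕ))) ^ 2)) ξ ∂ch.law :=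
        lintegral_mono fun ξ => ofReal_sq_decodingError_le hd hB b ξ ht
    _ = ∑ τ : Fin (t + 1), ENNReal.ofReal ((c * r ^ (t + 1 - (τ : ℕ))) ^ 2) *
          ch.law (firstErrorAt ch code b t τ) := by
        rw [lintegral_finsetSum _ fun τ _ =>
          measurable_const.indicator (measurableSet_firstErrorAt ch code b t τ)]
        exact Finset.sum_congr rfl fun τ _ =>
          lintegral_indicator_const (measurableSet_firstErrorAt ch code b t τ) _
    _ ≤ ∑ τ : Fin (t + 1), ENNReal.ofReal (c ^ 2 * η * q ^ (t + 1 - (τ : ℕ))) := by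
        refine Finset.sum_le_sum fun τ _ => ?_
        refine (mul_le_mul_right (hη b t τ (by omega)) _).trans (le_of_eq ?_)
        rw [← ENNReal.ofReal_mul (by positivity)]
        congr 1
        rw [hq, mul_pow, mul_pow, ← pow_mul, ← pow_mul, mul_comm 2]
        ring
    _ = ENNReal.ofReal (c ^ 2 * η * ∑ i ∈ Finset.range (t + 1), q ^ (i + 1)) := by
        rw [← ENNReal.ofReal_sum_of_nonneg fun τ _ => by positivity, ← Finset.mul_sum,
          Finset.sum_range]
        rw [← Equiv.sum_comp Fin.revPerm]
        congr 2
        refine Finset.sum_congr rfl fun i _ => ?_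
        congr 1
        simp [Fin.rev]
        omega
    _ ≤ ENNReal.ofReal (c ^ 2 * η * (1 / (1 - q))) := by
        refine ENNReal.ofReal_le_ofReal ?_
        gcongr
        calc ∑ i ∈ Finset.range (t + 1), q ^ (i + 1) ≤ ∑ i ∈ Finset.range (t + 1), q ^ i := by
              refine Finset.sum_le_sum fun i _ => ?_
              exact pow_le_pow_of_le_one hq0.le hrβ.le (by omega)
          _ ≤ _ := by
              rw [geom_sum_eq hrβ.ne, ← neg_div_neg_eq]
              have : 0 < 1 - q := by linarith
              have h2 : 0 ≤ q ^ (t + 1) := by positivity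
              rw [neg_sub, neg_sub]
              gcongr
              linarith

/-- The scheme of a suitable design stabilizes the plant. -/
theorem IsSuitable.stabilizesMeanSquare {W V X₀ : ℝ} (hd : d.IsSuitable (W / 2) (V / 2) X₀ ε C r)
    (hcode : IsAnytimeReliable ch code R β) (hrβ : (2 : ℝ) ^ (-(n * β)) * r ^ 2 < 1) :
    StabilizesMeanSquare d.F d.G d.H ch code W V X₀ d.scheme := by
  intro Ω _ P _ x₀ w v _ _ _ hx₀ hw hv
  have := ch.isProb
  obtain ⟨A, B, hA, hB, hAB⟩ := exists_norm_closedLoopState_le (n := n) (𝒵 := 𝒵) (Ξ := Ξ) hd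
  obtain ⟨s₀, K, hK⟩ := exists_lintegral_sq_decodingError_le hd hcode hrβ
  set N : ℝ := (Fintype.card X : ℝ) with hN
  -- From `(A + B(u + v))² ≤ 2A² + 4B²(u² + v²)`; the factor `N` compares the Euclidean norm with
  -- the sup norm.
  set L := ENNReal.ofReal (N * (2 * A ^ 2)) + ENNReal.ofReal (N * (4 * B ^ 2)) *
    (ENNReal.ofReal K + ENNReal.ofReal K) with hL
  have hLtop : L < ⊤ := by
    simp only [hL]
    finiteness
  refine lt_of_le_of_lt (limsup_le_of_le (a := L) (by isBoundedDefault) ?_) hLtop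
  have hP : 0 < d.P := by have := hd.M_lt; omega
  filter_upwards [eventually_ge_atTop ((s₀ + 3) * d.P)] with t ht
  have hs : s₀ + 3 ≤ t / d.P := (Nat.le_div_iff_mul_le hP).2 ht
  obtain ⟨s, hs'⟩ : ∃ s, t / d.P = s + 3 := ⟨t / d.P - 3, by omega⟩
  have htd : t = (s + 3) * d.P + t % d.P := by
    rw [← hs', mul_comm]; exact (Nat.div_add_mod t d.P).symm
  -- An upper bound by the iterated integral needs no joint measurability of the state.
  refine (lintegral_prod_le _).trans ?_
  have hae : ∀ᵐ ω ∂P, ∫⁻ ξ, ENNReal.ofReal (∑ i, closedLoopState d.F d.G d.H ch code d.scheme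
      (x₀ ω) (fun s => w s ω) (fun s => v s ω) ξ t i ^ 2) ∂ch.law ≤ L := by
    filter_upwards [hx₀, ae_all_iff.2 hw, ae_all_iff.2 hv] with ω h1 h2 h3
    -- With `ω` fixed the messages are deterministic, and the reliability bound applies to the inner
    -- integral over the channel.
    set b := d.sentMessages (x₀ ω) (fun s => w s ω) (fun s => v s ω)
    have hpt : ∀ ξ, ENNReal.ofReal (∑ i, closedLoopState d.F d.G d.H ch code d.scheme
        (x₀ ω) (fun s => w s ω) (fun s => v s ω) ξ t i ^ 2) ≤
        ENNReal.ofReal (N * (2 * A ^ 2)) + ENNReal.ofReal (N * (4 * B ^ 2)) *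
          (ENNReal.ofReal (d.decodingError ch code b ξ (s + 2) ^ 2) +
            ENNReal.ofReal (d.decodingError ch code b ξ (s + 3) ^ 2)) := by
      intro ξ
      rw [← ENNReal.ofReal_add (by positivity) (by positivity),
        ← ENNReal.ofReal_mul (by positivity), ← ENNReal.ofReal_add (by positivity) (by positivity)]
      refine ENNReal.ofReal_le_ofReal ?_
      have hbound := hAB ch code (x₀ ω) (fun s => w s ω) (fun s => v s ω) h1
        (fun t => (h2 t).le) (fun t => (h3 t).le) ξ s (t % d.P) (Nat.mod_lt _ hP)
      rw [← htd] at hbound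
      set x := closedLoopState d.F d.G d.H ch code d.scheme
        (x₀ ω) (fun s => w s ω) (fun s => v s ω) ξ t
      set E2 := d.decodingError ch code b ξ (s + 2)
      set E3 := d.decodingError ch code b ξ (s + 3)
      have hsum : ∑ i, x i ^ 2 ≤ N * ‖x‖ ^ 2 := by
        calc ∑ i, x i ^ 2 ≤ ∑ _i : X, ‖x‖ ^ 2 := by
              refine Finset.sum_le_sum fun i _ => ?_
              rw [← sq_abs (x i)]
              exact pow_le_pow_left₀ (abs_nonneg _) (norm_le_pi_norm x i) 2
          _ = N * ‖x‖ ^ 2 := by simp [hN]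
      refine hsum.trans ?_
      rw [show N * (2 * A ^ 2) + N * (4 * B ^ 2) * (E2 ^ 2 + E3 ^ 2) =
        N * (2 * A ^ 2 + 4 * B ^ 2 * (E2 ^ 2 + E3 ^ 2)) by ring]
      refine mul_le_mul_of_nonneg_left ?_ (by positivity)
      refine (pow_le_pow_left₀ (norm_nonneg _) hbound 2).trans ?_
      nlinarith [sq_nonneg (A - B * (E2 + E3)), mul_nonneg (sq_nonneg B) (sq_nonneg (E2 - E3))]
    refine (lintegral_mono hpt).trans ?_
    rw [lintegral_add_left measurable_const, lintegral_const, measure_univ, mul_one,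
      lintegral_const_mul' _ _ ENNReal.ofReal_ne_top]
    refine add_le_add le_rfl (mul_le_mul_right ?_ _)
    rw [lintegral_add_left (d.measurable_decodingError ch code b (s + 2)).ennreal_ofReal]
    exact add_le_add (hK b _ (by omega)) (hK b _ (by omega))
  calc _ ≤ ∫⁻ _, L ∂P := lintegral_mono_ae hae
    _ = L := by simp

end Design

/-! ### From state estimation to stabilization -/

section Stabilization

variable {X Y U : Type*} [Fintype X] [Fintype Y] [Fintype U] [DecidableEq X]

/-- Only noises from two successive periods enter, so the bound is uniform in time and involves no
controls. The mesh of the lattice can therefore be fixed in advance. -/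
theorem exists_norm_disturbance_le {F : Matrix X X ℝ} (H : Matrix Y X ℝ) {P M : ℕ} (hMP : M ≤ P)
    (Λ : (Fin M → Y → ℝ) →ₗ[ℝ] (X → ℝ)) {C r : ℝ} (hC : 0 ≤ C) (hr : 1 < r)
    (hF : ∀ (j : ℕ) (v : X → ℝ), ‖(F ^ j) *ᵥ v‖ ≤ C * r ^ j * ‖v‖) (w' v' : ℝ) :
    ∃ E : ℝ, ∀ (w : ℕ → X → ℝ) (v : ℕ → Y → ℝ), (∀ t, ‖w t‖ ≤ w') → (∀ t, ‖v t‖ ≤ v') → ∀ s,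
      ‖Λ (fun j => H *ᵥ inputResponse F w ((s + 1) * P) j + v ((s + 1) * P + j)) -
        (F ^ P) *ᵥ Λ (fun j => H *ᵥ inputResponse F w (s * P) j + v (s * P + j)) +
        inputResponse F w (s * P) P‖ ≤ E := by
  obtain ⟨h, hh0, hh⟩ := exists_norm_mulVec_le H
  obtain ⟨l, hl0, hl⟩ := exists_norm_linearMap_le Λ
  set D := C * w' / (r - 1) * r ^ P with hD
  refine ⟨l * (h * D + v') + C * r ^ P * (l * (h * D + v')) + D, fun w v hw hv s => ?_⟩
  have hw0 : 0 ≤ w' := (norm_nonneg _).trans (hw 0)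
  have hv0 : 0 ≤ v' := (norm_nonneg _).trans (hv 0)
  have hr1 : 0 < r - 1 := by linarith
  have hD0 : 0 ≤ D := by positivity
  have hresp : ∀ t, ∀ j ≤ P, ‖inputResponse F w t j‖ ≤ D := fun t j hj =>
    (norm_inputResponse_le hC hr hF t (fun s _ => hw s) j).trans
      (mul_le_mul_of_nonneg_left (pow_le_pow_right₀ hr.le hj) (by positivity))
  have hΛ : ∀ t, ‖Λ (fun j => H *ᵥ inputResponse F w t j + v (t + j))‖ ≤ l * (h * D + v') := by
    intro t
    refine (hl _).trans ?_
    gcongr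
    refine (pi_norm_le_iff_of_nonneg (by positivity)).2 fun j => ?_
    refine (norm_add_le _ _).trans (add_le_add ((hh _).trans ?_) (hv _))
    gcongr
    exact hresp t j (j.2.le.trans hMP)
  refine (norm_add_le _ _).trans (add_le_add ((norm_sub_le _ _).trans
    (add_le_add (hΛ _) ((hF _ _).trans ?_))) (hresp _ _ le_rfl))
  gcongr
  exact hΛ _

/-- A controllable and observable plant can be stabilized in the mean squared sense with an anytime
reliable code, if the messages suffice for estimating the state of the uncontrolled plant. -/
theorem exists_stabilizing_scheme {n k : ℕ} {𝒵 Ξ : Type*} [MeasurableSpace 𝒵] [MeasurableSpace Ξ]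
    (F : Matrix X X ℝ) (G : Matrix X U ℝ) (H : Matrix Y X ℝ) (hF : 1 < specRadius F)
    (hFG : IsControllable F G) (hobs : ∀ x, (∀ j : ℕ, H *ᵥ ((F ^ j) *ᵥ x) = 0) → x = 0)
    (W V X₀ : ℝ) (ch : Channel n 𝒵 Ξ) (code : Code n k 𝒵) (R β : ℝ)
    (hcode : IsAnytimeReliable ch code R β)
    (hβ : specRadius F ^ 2 * (2 : ℝ) ^ (-(n * β)) < 1)
    (hest : ∃ (enc : (Y → ℝ) → (Fin k → ZMod 2)) (dec : (Fin k → ZMod 2) → (X → ℝ)) (ε : ℝ),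
      (∀ m, MeasurableSet {y | enc y = m}) ∧
      ∀ (x₀ : X → ℝ) (w : ℕ → X → ℝ) (v : ℕ → Y → ℝ) (p : ℕ → X → ℝ), ‖x₀‖ ≤ X₀ →
        (∀ t, ‖w t‖ ≤ W / 2) → (∀ t, ‖v t‖ ≤ V / 2) → p 0 = 0 →
        (∀ t, p (t + 1) = F *ᵥ p t +
          dec (enc (H *ᵥ trajectory F x₀ w t + v t - H *ᵥ p t))) →
        ∀ t, ‖trajectory F x₀ w t - p t‖ ≤ ε) :
    ∃ S : Scheme Y U k, StabilizesMeanSquare F G H ch code W V X₀ S := by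
  obtain ⟨enc, dec, ε, henc, hest⟩ := hest
  set ρ := specRadius F with hρ
  set θ := (2 : ℝ) ^ (-(n * β)) with hθ
  have hθ0 : 0 < θ := by positivity
  -- The strict inequality for `β` leaves room for some `r` above the spectral radius, by
  -- continuity.
  obtain ⟨r, hr, hrθ⟩ : ∃ r, ρ < r ∧ θ * r ^ 2 < 1 := by
    have hcont : Tendsto (fun r : ℝ => θ * r ^ 2) (nhdsWithin ρ (Set.Ioi ρ)) (nhds (θ * ρ ^ 2)) :=
      ((continuous_const.mul (continuous_pow 2)).tendsto ρ).mono_left nhdsWithin_le_nhds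
    have h1 := hcont.eventually_lt_const (show θ * ρ ^ 2 < 1 by linarith)
    obtain ⟨r, h2, h3⟩ := (h1.and self_mem_nhdsWithin).exists
    exact ⟨r, h3, h2⟩
  have hr1 : 1 < r := hF.trans hr
  obtain ⟨C, hC, hgrowth⟩ := exists_norm_pow_mulVec_le F (by linarith) hr
  obtain ⟨M, Λ, hΛ⟩ := exists_leftInverse_of_observable F H hobs
  obtain ⟨P, K, hMP, hK0, hK⟩ := exists_controls_of_controllable F G hFG M
  obtain ⟨E, hE⟩ := exists_norm_disturbance_le H hMP.le Λ hC hr1 hgrowth (W / 2) (V / 2)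
  -- The mesh `2 * |E| + 1` is more than twice any disturbance.
  let d : Design X Y U k :=
    { F := F, H := H, G := G, P := P, M := M, K := K, Λ := Λ, δ := 2 * |E| + 1, enc := enc,
      dec := dec, measurable_enc := henc }
  have hd : d.IsSuitable (W / 2) (V / 2) X₀ ε C r :=
    { M_lt := hMP
      idle := hK0
      displace := hK
      recover := hΛ
      mesh_pos := by positivity
      disturbance_lt := fun w v hw hv s => by
        have h1 : ‖d.disturbance w v s‖ ≤ E := hE w v hw hv s
        have h2 := le_abs_self E
        change _ < 2 * |E| + 1
        linarith
      estimate_error := fun x₀ w v hx₀ hw hv t =>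
        hest x₀ w v _ hx₀ hw hv rfl (fun _ => rfl) t
      growth_nonneg := hC
      one_lt := hr1
      growth := hgrowth }
  exact ⟨d.scheme, hd.stabilizesMeanSquare hcode hrθ⟩

end Stabilization

/-! ### Uniform quantization of an interval -/

section Quantizer

/-- The index of the cell of `x`, when `[-L, L]` is divided into `N` cells. -/
noncomputable def cell (L : ℝ) (N : ℕ) (hN : 0 < N) (x : ℝ) : Fin N :=
  ⟨min (N - 1) ⌊(x + L) * N / (2 * L)⌋₊, by omega⟩

/-- The midpoint of a cell. -/
noncomputable def cellMidpoint (L : ℝ) (N : ℕ) (g : Fin N) : ℝ :=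
  -L + ((g : ℝ) + 1 / 2) * (2 * L / N)

theorem abs_sub_cellMidpoint_le {L : ℝ} (hL : 0 < L) {N : ℕ} (hN : 0 < N) {x : ℝ}
    (hx : |x| ≤ L) : |x - cellMidpoint L N (cell L N hN x)| ≤ L / N := by
  obtain ⟨h1, h2⟩ := abs_le.1 hx
  have hN' : (0 : ℝ) < N := by positivity
  set u := (x + L) * N / (2 * L) with hu
  have hu0 : 0 ≤ u := div_nonneg (mul_nonneg (by linarith) hN'.le) (by linarith)
  have huN : u ≤ N := by
    rw [hu, div_le_iff₀ (by linarith)]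
    nlinarith
  have hxu : x = -L + u * (2 * L / N) := by
    rw [hu]; field_simp; ring
  -- The minimum with `N - 1` matters only at the right end `u = N`, which is attached to the last
  -- cell.
  have key : |u - ((min (N - 1) ⌊u⌋₊ : ℕ) + 1 / 2 : ℝ)| ≤ 1 / 2 := by
    have h3 := Nat.floor_le hu0
    have h4 := Nat.lt_floor_add_one u
    rcases le_total (N - 1) ⌊u⌋₊ with h | h
    · rw [min_eq_left h]
      have h5 : ((N - 1 : ℕ) : ℝ) = N - 1 := by rw [Nat.cast_sub (by omega)]; simp
      have h6 : ((N - 1 : ℕ) : ℝ) ≤ ⌊u⌋₊ := by exact_mod_cast h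
      rw [abs_le]
      constructor <;> linarith
    · rw [min_eq_right h, abs_le]
      constructor <;> linarith
  have e : x - cellMidpoint L N (cell L N hN x) =
      (u - ((min (N - 1) ⌊u⌋₊ : ℕ) + 1 / 2 : ℝ)) * (2 * L / N) := by
    have : ((cell L N hN x : ℕ) : ℝ) = (min (N - 1) ⌊u⌋₊ : ℕ) := rfl
    rw [cellMidpoint, this]
    conv_lhs => rw [hxu]
    ring
  rw [e, abs_mul, abs_of_nonneg (a := 2 * L / N) (by positivity)]
  calc _ ≤ 1 / 2 * (2 * L / N) := by gcongr
    _ = L / N := by ring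

theorem measurableSet_cell_eq (L : ℝ) (N : ℕ) (hN : 0 < N) (g : Fin N) :
    MeasurableSet {x | cell L N hN x = g} := by
  have h : Measurable fun x : ℝ => min (N - 1) ⌊(x + L) * N / (2 * L)⌋₊ :=
    measurable_const.min (Nat.measurable_floor.comp (by fun_prop))
  have e : {x | cell L N hN x = g} =
      (fun x : ℝ => min (N - 1) ⌊(x + L) * N / (2 * L)⌋₊) ⁻¹' {(g : ℕ)} := by
    ext x
    simp [cell, Fin.ext_iff]
  rw [e]
  exact h (measurableSet_singleton _)

end Quantizer

/-! ### State estimation in canonical form -/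

section CanonicalForm

variable {q r : ℕ} {ℓ : Fin q → ℕ} {a : (i : Fin q) → Fin (ℓ i) → ℝ}
  {A : Matrix (Idx ℓ) (Idx ℓ) ℝ} {D : Matrix (Fin q ⊕ Fin r) (Idx ℓ) ℝ}

theorem IsCanonicalForm.mulVec_apply (h : IsCanonicalForm a A D) (z : Idx ℓ → ℝ) (i : Fin q)
    (j : Fin (ℓ i)) :
    (A *ᵥ z) ⟨i, j⟩ = ∑ i' ∈ Finset.Iio i, ∑ j', A ⟨i, j⟩ ⟨i', j'⟩ * z ⟨i', j'⟩ +
      (-a i j * z ⟨i, ⟨0, j.pos⟩⟩ +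
        if hj : (j : ℕ) + 1 < ℓ i then z ⟨i, ⟨j + 1, hj⟩⟩ else 0) := by
  rw [Matrix.mulVec, dotProduct, Fintype.sum_sigma,
    ← Finset.sum_subset (Finset.subset_univ (Finset.Iic i))]
  · rw [← Finset.Iio_insert, Finset.sum_insert (by simp), add_comm]
    congr 1
    have hpos : 0 < ℓ i := j.pos
    have e : ∀ j' : Fin (ℓ i), A ⟨i, j⟩ ⟨i, j'⟩ * z ⟨i, j'⟩ =
        (if j' = ⟨0, hpos⟩ then -a i j * z ⟨i, j'⟩ else 0) +
        (if (j' : ℕ) = j + 1 then z ⟨i, j'⟩ else 0) := by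
      intro j'
      rw [h.diag]
      by_cases h0 : (j' : ℕ) = 0
      · simp [Fin.ext_iff, h0]
      · by_cases h1 : (j' : ℕ) = j + 1 <;> simp [Fin.ext_iff, h0, h1]
    simp only [e, Finset.sum_add_distrib, Finset.sum_ite_eq', Finset.mem_univ, if_true]
    congr 1
    split_ifs with hj
    · rw [Finset.sum_eq_single ⟨j + 1, hj⟩]
      · simp
      · intro b _ hb
        rw [if_neg fun hb' => hb (Fin.ext hb')]
      · simp
    · exact Finset.sum_eq_zero fun b _ => if_neg (by have := b.2; omega)
  · intro i' _ hi'
    refine Finset.sum_eq_zero fun j' _ => ?_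
    rw [h.upper i i' j j' (by simpa using hi'), zero_mul]

theorem IsCanonicalForm.meas_mulVec (h : IsCanonicalForm a A D) (z : Idx ℓ → ℝ) (i : Fin q) :
    (D *ᵥ z) (Sum.inl i) = if hi : 0 < ℓ i then z ⟨i, ⟨0, hi⟩⟩ else 0 := by
  rw [Matrix.mulVec, dotProduct, Fintype.sum_sigma, Finset.sum_eq_single i]
  · split_ifs with hi
    · rw [Finset.sum_eq_single ⟨0, hi⟩]
      · simp [h.meas]
      · intro b _ hb
        rw [h.meas, if_neg fun hb' => hb (Fin.ext hb'.2), zero_mul]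
      · simp
    · exact Finset.sum_eq_zero fun b _ => absurd b.2 (by omega)
  · intro b _ hb
    exact Finset.sum_eq_zero fun j _ => by
      rw [h.meas, if_neg fun hb' => hb hb'.1.symm, zero_mul]
  · simp

/-- A plant in canonical form is observable. -/
theorem IsCanonicalForm.observable (h : IsCanonicalForm a A D) (z : Idx ℓ → ℝ)
    (hz : ∀ j : ℕ, D *ᵥ ((A ^ j) *ᵥ z) = 0) : z = 0 := by
  have hsucc : ∀ t, (A ^ (t + 1)) *ᵥ z = A *ᵥ ((A ^ t) *ᵥ z) := fun t => by
    rw [Matrix.mulVec_mulVec, pow_succ']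
  -- The ones above the diagonal express coordinate `j + 1` at time `t` by coordinate `j` at time `t
  -- + 1`, the measured first coordinate and earlier blocks. Hence the induction is over blocks and
  -- coordinates, for all times at once.
  have key : ∀ (i : Fin q) (j : ℕ) (hj : j < ℓ i) (t : ℕ), ((A ^ t) *ᵥ z) ⟨i, ⟨j, hj⟩⟩ = 0 := by
    intro i
    induction i using WellFoundedLT.induction with
    | _ i ih =>
      intro j
      induction j with
      | zero =>
        intro hj t
        have h1 := congrFun (hz t) (Sum.inl i)
        rwa [h.meas_mulVec, dif_pos hj] at h1
      | succ j ihj =>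
        intro hj t
        have h1 := ihj (by omega) (t + 1)
        rw [hsucc, h.mulVec_apply, dif_pos hj, Finset.sum_eq_zero] at h1
        · have h2 : ((A ^ t) *ᵥ z) ⟨i, ⟨0, by omega⟩⟩ = 0 := by
            have h3 := congrFun (hz t) (Sum.inl i)
            rwa [h.meas_mulVec, dif_pos (by omega)] at h3
          rw [h2] at h1
          simpa using h1
        · intro i' hi'
          refine Finset.sum_eq_zero fun j' _ => ?_
          rw [ih i' (Finset.mem_Iio.1 hi') j' j'.2 t, mul_zero]
  funext ⟨i, j⟩
  simpa using key i j j.2 0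

/-- The weights `c (1 + Q) ^ i` dominate `Q` times the sum of the preceding weights. -/
theorem add_sum_Iio_weights (c Q : ℝ) (i : Fin q) :
    c + ∑ i' ∈ Finset.Iio i, Q * (c * (1 + Q) ^ (i' : ℕ)) = c * (1 + Q) ^ (i : ℕ) := by
  have e : ∑ i' ∈ Finset.Iio i, Q * (c * (1 + Q) ^ (i' : ℕ)) =
      ∑ m ∈ Finset.range i, Q * (c * (1 + Q) ^ m) := by
    rw [← Nat.Iio_eq_range, ← Fin.map_valEmbedding_Iio, Finset.sum_map]
    rfl
  rw [e]
  induction (i : ℕ) with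
  | zero => simp
  | succ m ih => rw [Finset.sum_range_succ, ← add_assoc, ih]; ring

/-- Bounds for the estimation error that are invariant: `b i j` for the coordinate `j` of block `i`,
which becomes `m i` for the first coordinate when its measurement has been quantized with `N i`
levels. -/
theorem exists_invariant_box (a : (i : Fin q) → Fin (ℓ i) → ℝ) (A : Matrix (Idx ℓ) (Idx ℓ) ℝ)
    (N : Fin q → ℕ) (hN : ∀ i, ∑ j, |a i j| < N i) {c : ℝ} (hc : 0 < c) :
    ∃ (m : Fin q → ℝ) (b : Fin q → ℕ → ℝ), (∀ i j, 0 ≤ b i j ∧ b i j ≤ b i 0) ∧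
      (∀ i, (b i 0 + c) / N i + c ≤ m i) ∧ (∀ i (j : Fin (ℓ i)), c ≤ b i j) ∧
      ∀ i (j : Fin (ℓ i)), ∑ i' ∈ Finset.Iio i, ∑ j' : Fin (ℓ i'),
        |A ⟨i, j⟩ ⟨i', j'⟩| * (if (j' : ℕ) = 0 then m i' else b i' j') +
        (|a i j| * m i + b i (j + 1)) + c ≤ b i j := by
  set s : Fin q → ℝ := fun i => ∑ j, |a i j| with hs
  have hs0 : ∀ i, 0 ≤ s i := fun i => Finset.sum_nonneg fun j _ => abs_nonneg _
  have hN1 : ∀ i, (1 : ℝ) ≤ N i := fun i => by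
    have h : (0 : ℝ) < N i := (hs0 i).trans_lt (hN i)
    exact_mod_cast h
  have hgap : ∀ i, 0 < 1 - s i / N i := fun i => by
    have := (div_lt_one (by linarith [hN1 i])).2 (hN i)
    linarith
  -- Chosen so that `m i = μ i * ω i` solves `m i = (s i / N i) * m i + (ℓ i + 2) * ω i`. This is
  -- where `s i < N i` is needed.
  set μ : Fin q → ℝ := fun i => (ℓ i + 2) / (1 - s i / N i) with hμ
  have hμ0 : ∀ i, 0 ≤ μ i := fun i => div_nonneg (by positivity) (hgap i).le
  -- All error bounds of block `i` will be at most `Q * ω i`.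
  set Q : ℝ := ∑ i, (μ i + s i * μ i + ℓ i) with hQ
  have hQi : ∀ i, μ i + s i * μ i + ℓ i ≤ Q := fun i =>
    Finset.single_le_sum (f := fun i => μ i + s i * μ i + (ℓ i : ℝ)) (fun i _ => by
      have := hμ0 i; have := hs0 i; positivity) (Finset.mem_univ i)
  have hQ0 : 0 ≤ Q := Finset.sum_nonneg fun i _ => by
    have := hμ0 i; have := hs0 i; positivity
  set Γ : ℝ := ∑ x, ∑ y, |A x y| with hΓ
  have hΓ0 : 0 ≤ Γ := by positivity
  have hrow : ∀ x, ∀ i', ∑ j', |A x ⟨i', j'⟩| ≤ Γ := by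
    intro x i'
    calc ∑ j', |A x ⟨i', j'⟩| ≤ ∑ i', ∑ j', |A x ⟨i', j'⟩| :=
          Finset.single_le_sum (f := fun i' => ∑ j', |A x ⟨i', j'⟩|) (fun i _ => by positivity)
            (Finset.mem_univ i')
      _ = ∑ y, |A x y| := by rw [Fintype.sum_sigma]
      _ ≤ Γ := Finset.single_le_sum (f := fun x => ∑ y, |A x y|) (fun i _ => by positivity)
            (Finset.mem_univ x)
  -- `ω i` is the noise level `c` plus the bound `Γ * Q * ω i'` for the influence of each earlier
  -- block; it grows geometrically because the blocks form a cascade.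
  set ω : Fin q → ℝ := fun i => c * (1 + Γ * Q) ^ (i : ℕ) with hω
  have hωc : ∀ i, c ≤ ω i := fun i =>
    le_mul_of_one_le_right hc.le (one_le_pow₀ (by linarith [mul_nonneg hΓ0 hQ0]))
  have hω0 : ∀ i, 0 ≤ ω i := fun i => hc.le.trans (hωc i)
  set m : Fin q → ℝ := fun i => μ i * ω i with hm
  have hm0 : ∀ i, 0 ≤ m i := fun i => mul_nonneg (hμ0 i) (hω0 i)
  -- Tail sums solve the recursion `b i j = |a i j| * m i + ω i + b i (j + 1)` imposed by the
  -- companion block, with value `0` past its end.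
  set b : Fin q → ℕ → ℝ := fun i j =>
    ∑ j' : Fin (ℓ i), if j ≤ (j' : ℕ) then |a i j'| * m i + ω i else 0 with hb
  have hterm : ∀ i (j : Fin (ℓ i)), 0 ≤ |a i j| * m i + ω i := fun i j =>
    add_nonneg (mul_nonneg (abs_nonneg _) (hm0 i)) (hω0 i)
  have hb0 : ∀ i j, 0 ≤ b i j := fun i j => Finset.sum_nonneg fun j' _ => by
    split_ifs
    · exact hterm i j'
    · exact le_rfl
  have hbzero : ∀ i, b i 0 = s i * m i + ℓ i * ω i := fun i => by
    simp only [hb, zero_le, if_true, Finset.sum_add_distrib, ← Finset.sum_mul, Finset.sum_const,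
      Finset.card_univ, Fintype.card_fin, nsmul_eq_mul, hs]
  have hble : ∀ i j, b i j ≤ b i 0 := fun i j => Finset.sum_le_sum fun j' _ => by
    simp only [zero_le, if_true]
    split_ifs
    · exact le_rfl
    · exact hterm i j'
  have hbsucc : ∀ i (j : Fin (ℓ i)), b i j = |a i j| * m i + ω i + b i (j + 1) := by
    intro i j
    have e : ∀ j' : Fin (ℓ i), (if (j : ℕ) ≤ j' then |a i j'| * m i + ω i else 0) =
        (if j' = j then |a i j'| * m i + ω i else 0) +
        (if (j : ℕ) + 1 ≤ j' then |a i j'| * m i + ω i else 0) := by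
      intro j'
      rcases lt_trichotomy (j : ℕ) j' with h | h | h
      · rw [if_pos h.le, if_neg (fun h' => by rw [h'] at h; omega), if_pos (show (j : ℕ) + 1 ≤ j' from h),
          zero_add]
      · rw [if_pos h.le, if_pos (Fin.ext h.symm), if_neg (by omega), add_zero]
      · rw [if_neg (by omega), if_neg (fun h' => by rw [h'] at h; omega), if_neg (by omega),
          zero_add]
    simp only [hb, e, Finset.sum_add_distrib, Finset.sum_ite_eq', Finset.mem_univ, if_true]
  have hsize : ∀ i j, (if j = 0 then m i else b i j) ≤ Q * ω i := by
    intro i j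
    refine le_trans ?_ (mul_le_mul_of_nonneg_right (hQi i) (hω0 i))
    have h1 : 0 ≤ m i := hm0 i
    have h2 : 0 ≤ s i * m i := mul_nonneg (hs0 i) h1
    have h3 : 0 ≤ (ℓ i : ℝ) * ω i := mul_nonneg (Nat.cast_nonneg _) (hω0 i)
    have h4 : (μ i + s i * μ i + ℓ i) * ω i = m i + s i * m i + ℓ i * ω i := by
      simp only [hm]; ring
    rw [h4]
    split_ifs
    · linarith
    · linarith [hble i j, hbzero i]
  refine ⟨m, b, fun i j => ⟨hb0 i j, hble i j⟩, fun i => ?_, fun i j => ?_, fun i j => ?_⟩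
  · have hNi := hN1 i
    have h1 : (1 - s i / N i) * m i = (ℓ i + 2) * ω i := by
      simp only [hm, hμ]
      rw [← mul_assoc, mul_div_cancel₀ _ (hgap i).ne']
    have h2 : (b i 0 + c) / N i = s i / N i * m i + (ℓ i * ω i + c) / N i := by
      rw [hbzero]; ring
    have h3 : (ℓ i * ω i + c) / N i ≤ ℓ i * ω i + c :=
      div_le_self (add_nonneg (mul_nonneg (Nat.cast_nonneg _) (hω0 i)) hc.le) hNi
    have h4 := hωc i
    rw [h2]
    linarith
  · rw [hbsucc]
    have h1 := hb0 i (j + 1)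
    have h2 : 0 ≤ |a i j| * m i := mul_nonneg (abs_nonneg _) (hm0 i)
    linarith [hωc i]
  · have h1 : ∑ i' ∈ Finset.Iio i, ∑ j' : Fin (ℓ i'),
        |A ⟨i, j⟩ ⟨i', j'⟩| * (if (j' : ℕ) = 0 then m i' else b i' j') ≤
        ∑ i' ∈ Finset.Iio i, Γ * Q * ω i' := by
      refine Finset.sum_le_sum fun i' _ => ?_
      calc ∑ j' : Fin (ℓ i'), |A ⟨i, j⟩ ⟨i', j'⟩| * (if (j' : ℕ) = 0 then m i' else b i' j')
          ≤ ∑ j' : Fin (ℓ i'), |A ⟨i, j⟩ ⟨i', j'⟩| * (Q * ω i') :=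
            Finset.sum_le_sum fun j' _ => mul_le_mul_of_nonneg_left (hsize i' j') (abs_nonneg _)
        _ ≤ Γ * (Q * ω i') := by
            rw [← Finset.sum_mul]
            exact mul_le_mul_of_nonneg_right (hrow _ i') (mul_nonneg hQ0 (hω0 i'))
        _ = _ := by ring
    have h2 := add_sum_Iio_weights c (Γ * Q) i
    rw [hbsucc]
    simp only [hω] at h1 ⊢
    linarith

/-- The state of an uncontrolled plant in canonical form can be estimated with a bounded error from
`∑ i, κ i` bits per time step, if `∑ j, |a i j| < 2 ^ κ i` for all `i`. -/
theorem IsCanonicalForm.exists_estimator (h : IsCanonicalForm a A D) {k : ℕ} (κ : Fin q → ℕ)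
    (hκ : ∑ i, κ i ≤ k) (hc : ∀ i, ∑ j, |a i j| < 2 ^ κ i) (w' v' z' : ℝ) :
    ∃ (enc : (Fin q ⊕ Fin r → ℝ) → (Fin k → ZMod 2)) (dec : (Fin k → ZMod 2) → (Idx ℓ → ℝ))
      (ε : ℝ), (∀ m, MeasurableSet {y | enc y = m}) ∧
      ∀ (z w : ℕ → Idx ℓ → ℝ) (v : ℕ → Fin q ⊕ Fin r → ℝ) (p : ℕ → Idx ℓ → ℝ), ‖z 0‖ ≤ z' →
        (∀ t, ‖w t‖ ≤ w') → (∀ t, ‖v t‖ ≤ v') → (∀ t, z (t + 1) = A *ᵥ z t + w t) → p 0 = 0 →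
        (∀ t, p (t + 1) = A *ᵥ p t + dec (enc (D *ᵥ z t + v t - D *ᵥ p t))) →
        ∀ t, ‖z t - p t‖ ≤ ε := by
  set c : ℝ := 1 + |w'| + |v'| + |z'| with hcdef
  have hc0 : 0 < c := by positivity
  obtain ⟨m, b, hb, hm, hbc, hinv⟩ :=
    exists_invariant_box a A (fun i => 2 ^ κ i) (fun i => by simpa using hc i) hc0
  have hb0 : ∀ i, 0 ≤ b i 0 := fun i => (hb i 0).1
  have hN : ∀ i, 0 < (2 : ℕ) ^ κ i := fun i => by positivity
  have hcard : Fintype.card ((i : Fin q) → Fin (2 ^ κ i)) ≤ Fintype.card (Fin k → ZMod 2) := by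
    simp only [Fintype.card_pi, Fintype.card_fin, Finset.prod_pow_eq_pow_sum, ZMod.card,
      Finset.prod_const, Finset.card_univ]
    exact Nat.pow_le_pow_right (by norm_num) hκ
  obtain ⟨f⟩ := Function.Embedding.nonempty_of_card_le hcard
  -- The quantized quantity is the first coordinate of the error plus measurement noise, whence the
  -- additional `c`.
  set L : Fin q → ℝ := fun i => b i 0 + c with hL
  have hL0 : ∀ i, 0 < L i := fun i => by have := hb0 i; positivity
  let cells : (Fin q ⊕ Fin r → ℝ) → (i : Fin q) → Fin (2 ^ κ i) := fun y i =>
    cell (L i) (2 ^ κ i) (hN i) (y (Sum.inl i))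
  let corr : ((i : Fin q) → Fin (2 ^ κ i)) → Idx ℓ → ℝ := fun g x =>
    if (x.2 : ℕ) = 0 then cellMidpoint (L x.1) (2 ^ κ x.1) (g x.1) else 0
  have hne : Nonempty ((i : Fin q) → Fin (2 ^ κ i)) := ⟨fun i => ⟨0, hN i⟩⟩
  have hinvf : ∀ g, Function.invFun f (f g) = g := Function.leftInverse_invFun f.injective
  -- The correction belongs to the estimate before the time step, so the decoder applies `A` to it.
  refine ⟨fun y => f (cells y), fun g => A *ᵥ corr (Function.invFun f g), ∑ i, b i 0, ?_, ?_⟩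
  · intro g
    have hcells : ∀ g', MeasurableSet {y | cells y = g'} := by
      intro g'
      have e : {y | cells y = g'} = ⋂ i, (fun y : Fin q ⊕ Fin r → ℝ => y (Sum.inl i)) ⁻¹'
          {x | cell (L i) (2 ^ κ i) (hN i) x = g' i} := by
        ext y
        simp [cells, funext_iff]
      rw [e]
      exact MeasurableSet.iInter fun i =>
        measurable_pi_apply (Sum.inl i) (measurableSet_cell_eq (L i) (2 ^ κ i) (hN i) (g' i))
    have e : {y | f (cells y) = g} = ⋃ g' ∈ {g' | f g' = g}, {y | cells y = g'} := by
      ext y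
      simp
    rw [e]
    exact MeasurableSet.biUnion (Set.to_countable _) fun g' _ => hcells g'
  · intro z w v p hz hw hv hzrec hp0 hprec
    have hwc : ∀ t x, |w t x| ≤ c := fun t x =>
      (norm_le_pi_norm (w t) x).trans ((hw t).trans (by
        have := le_abs_self w'; have := abs_nonneg v'; have := abs_nonneg z'; linarith))
    have hvc : ∀ t x, |v t x| ≤ c := fun t x =>
      (norm_le_pi_norm (v t) x).trans ((hv t).trans (by
        have := le_abs_self v'; have := abs_nonneg w'; have := abs_nonneg z'; linarith))
    have hbox : ∀ t x, |z t x - p t x| ≤ b x.1 x.2 := by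
      intro t
      induction t with
      | zero =>
        rintro ⟨i, j⟩
        rw [hp0, Pi.zero_apply, sub_zero]
        refine le_trans ?_ (hbc i j)
        exact (norm_le_pi_norm (z 0) _).trans (hz.trans (by
          have := le_abs_self z'; have := abs_nonneg w'; have := abs_nonneg v'; linarith))
      | succ t ih =>
        set e : Idx ℓ → ℝ := z t - p t with he
        set g := cells (D *ᵥ z t + v t - D *ᵥ p t) with hg
        set e' : Idx ℓ → ℝ := e - corr g with he'
        have hrec : z (t + 1) - p (t + 1) = A *ᵥ e' + w t := by
          rw [hzrec, hprec]
          beta_reduce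
          rw [hinvf, he', he, Matrix.mulVec_sub, Matrix.mulVec_sub]
          abel
        have hfirst : ∀ i (hi : 0 < ℓ i), |e' ⟨i, ⟨0, hi⟩⟩| ≤ m i := by
          intro i hi
          have hy : (D *ᵥ z t + v t - D *ᵥ p t) (Sum.inl i) =
              e ⟨i, ⟨0, hi⟩⟩ + v t (Sum.inl i) := by
            have e1 : D *ᵥ z t + v t - D *ᵥ p t = D *ᵥ e + v t := by
              rw [he, Matrix.mulVec_sub]; abel
            rw [e1, Pi.add_apply, h.meas_mulVec, dif_pos hi]
          set y := e ⟨i, ⟨0, hi⟩⟩ + v t (Sum.inl i) with hydef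
          have hyL : |y| ≤ L i := (abs_add_le _ _).trans (add_le_add (ih ⟨i, ⟨0, hi⟩⟩) (hvc _ _))
          have h1 := abs_sub_cellMidpoint_le (hL0 i) (hN i) hyL
          have h2 : e' ⟨i, ⟨0, hi⟩⟩ =
              (y - cellMidpoint (L i) (2 ^ κ i) (cell (L i) (2 ^ κ i) (hN i) y)) -
                v t (Sum.inl i) := by
            have h3 : corr g ⟨i, ⟨0, hi⟩⟩ =
                cellMidpoint (L i) (2 ^ κ i) (cell (L i) (2 ^ κ i) (hN i) y) := by
              simp only [corr, if_true, hg, cells, hy]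
            rw [he', Pi.sub_apply, h3, hydef]
            ring
          rw [h2]
          exact (abs_sub _ _).trans ((add_le_add h1 (hvc _ _)).trans (hm i))
        have hbound : ∀ i (j : Fin (ℓ i)), |e' ⟨i, j⟩| ≤ if (j : ℕ) = 0 then m i else b i j := by
          intro i j
          split_ifs with hj
          · have := hfirst i j.pos
            rwa [show (⟨0, j.pos⟩ : Fin (ℓ i)) = j from Fin.ext hj.symm] at this
          · have h1 : e' ⟨i, j⟩ = e ⟨i, j⟩ := by simp [he', corr, hj]
            rw [h1]
            exact ih ⟨i, j⟩
        rintro ⟨i, j⟩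
        have hzp := congrFun hrec ⟨i, j⟩
        rw [Pi.sub_apply, Pi.add_apply, h.mulVec_apply] at hzp
        rw [hzp]
        refine le_trans ?_ (hinv i j)
        refine (abs_add_le _ _).trans (add_le_add ((abs_add_le _ _).trans (add_le_add ?_
          ((abs_add_le _ _).trans (add_le_add ?_ ?_)))) (hwc _ _))
        · refine (Finset.abs_sum_le_sum_abs _ _).trans (Finset.sum_le_sum fun i' _ => ?_)
          refine (Finset.abs_sum_le_sum_abs _ _).trans (Finset.sum_le_sum fun j' _ => ?_)
          rw [abs_mul]
          exact mul_le_mul_of_nonneg_left (hbound i' j') (abs_nonneg _)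
        · rw [abs_mul, abs_neg]
          exact mul_le_mul_of_nonneg_left (hfirst i j.pos) (abs_nonneg _)
        · split_ifs with hj
          · simpa using hbound i ⟨j + 1, hj⟩
          · simpa using (hb i (j + 1)).1
    intro t
    refine (pi_norm_le_iff_of_nonneg (Finset.sum_nonneg fun i _ => hb0 i)).2 fun x => ?_
    exact (hbox t x).trans ((hb _ _).2.trans
      (Finset.single_le_sum (f := fun i => b i 0) (fun i _ => hb0 i) (Finset.mem_univ x.1)))

/-! ### Allocation of bits to the blocks -/

theorem four_pow_pred_le_pow_self {s : ℕ} (hs : 1 ≤ s) : 4 ^ (s - 1) ≤ s ^ s := by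
  rcases lt_or_ge s 4 with h | h
  · interval_cases s <;> norm_num
  · exact (Nat.pow_le_pow_right (by norm_num) (Nat.sub_le s 1)).trans (Nat.pow_le_pow_left h s)

/-- The logarithm of `4 ^ (s - 1) ≤ s ^ s ≤ m ^ s`. Rounding up costs at most one bit in each of `s`
blocks; integrality of the total saves one of these bits, and the factors `√m` pay for the others.
-/
theorem sub_one_le_mul_logb_sqrt {s m : ℕ} (hsm : s ≤ m) :
    (s : ℝ) - 1 ≤ s * Real.logb 2 √(m : ℝ) := by
  rcases Nat.eq_zero_or_pos s with rfl | hs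
  · simp
  have hs' : (0 : ℝ) < s := by exact_mod_cast hs
  have h1 : ((4 : ℝ) ^ (s - 1)) ≤ (s : ℝ) ^ s := by exact_mod_cast four_pow_pred_le_pow_self hs
  have h2 := Real.logb_le_logb_of_le (b := 2) (by norm_num) (by positivity) h1
  rw [Real.logb_pow, Real.logb_pow, Nat.cast_sub hs, Nat.cast_one,
    show (4 : ℝ) = 2 ^ 2 by norm_num, Real.logb_pow, Real.logb_self_eq_one (by norm_num)] at h2
  have h3 : Real.logb 2 (s : ℝ) ≤ Real.logb 2 (m : ℝ) :=
    Real.logb_le_logb_of_le (by norm_num) hs' (by exact_mod_cast hsm)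
  have h4 : Real.logb 2 √(m : ℝ) = Real.logb 2 m / 2 := by
    simp only [Real.logb, Real.log_sqrt (Nat.cast_nonneg m)]
    ring
  rw [h4]
  push_cast at h2
  nlinarith

/-- Of `theta` only this is used, so its powers in the threshold can be dropped. For `m = 1` the
exponent is forced to be `0`, and the junk value does not matter. -/
theorem le_theta_pow {m j l : ℕ} (hj : j < l) (hl : l ≤ m) : 1 ≤ theta m ^ j := by
  rcases Nat.eq_zero_or_pos j with rfl | hj0
  · simp
  · have hm : (2 : ℝ) ≤ m := by exact_mod_cast (by omega : 2 ≤ m)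
    refine one_le_pow₀ (Real.one_le_sqrt.2 ?_)
    rw [le_div_iff₀ (by linarith)]
    linarith

/-- Below the rate of the code, the bits of a message can be allocated to the blocks: the factor
`√m` in the threshold makes up for rounding up the number of bits in each block. -/
theorem exists_bit_allocation {n k : ℕ} (a : (i : Fin q) → Fin (ℓ i) → ℝ)
    (hR : rateThreshold n a < (k : ℝ) / n) :
    ∃ κ : Fin q → ℕ, ∑ i, κ i ≤ k ∧ ∀ i, ∑ j, |a i j| < 2 ^ κ i := by
  rcases Nat.eq_zero_or_pos n with rfl | hn
  · simp [rateThreshold] at hR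
  have hn' : (0 : ℝ) < n := by exact_mod_cast hn
  set m := ∑ i', ℓ i' with hm
  set s : Fin q → ℝ := fun i => ∑ j, |a i j| with hs
  set B : Fin q → ℝ := fun i => Real.logb 2 (√(m : ℝ) * ∑ j, |a i j| * theta m ^ (j : ℕ)) with hB
  have hk : ∑ i, max 0 (B i) < k := by
    have h1 : (1 / n : ℝ) * ∑ i, max 0 (B i) < (k : ℝ) / n := hR
    rwa [one_div, inv_mul_eq_div, div_lt_div_iff_of_pos_right hn'] at h1
  have hℓm : ∀ i, ℓ i ≤ m := fun i =>
    Finset.single_le_sum (f := ℓ) (fun _ _ => Nat.zero_le _) (Finset.mem_univ i)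
  set S : Finset (Fin q) := Finset.univ.filter fun i => 1 ≤ s i with hS
  have hcard : S.card ≤ m := by
    calc S.card = ∑ i ∈ S, 1 := by simp
      _ ≤ ∑ i ∈ S, ℓ i := by
        refine Finset.sum_le_sum fun i hi => ?_
        by_contra hlt
        have h0 : ℓ i = 0 := by omega
        have h1 : s i = 0 := Finset.sum_eq_zero fun j _ => absurd j.2 (by omega)
        have h2 := (Finset.mem_filter.1 hi).2
        rw [h1] at h2
        linarith
      _ ≤ m := Finset.sum_le_sum_of_subset (Finset.subset_univ _)
  have hlog : ∀ i ∈ S, Real.logb 2 √(m : ℝ) + Real.logb 2 (s i) ≤ B i := by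
    intro i hi
    have hsi : 1 ≤ s i := (Finset.mem_filter.1 hi).2
    have hm0 : (0 : ℝ) < √(m : ℝ) := by
      have h1 : 0 < S.card := Finset.card_pos.2 ⟨i, hi⟩
      have h2 : (0 : ℝ) < m := by exact_mod_cast h1.trans_le hcard
      positivity
    rw [← Real.logb_mul hm0.ne' (by linarith)]
    refine Real.logb_le_logb_of_le (by norm_num) (by positivity) ?_
    refine mul_le_mul_of_nonneg_left (Finset.sum_le_sum fun j _ => ?_) hm0.le
    exact le_mul_of_one_le_right (abs_nonneg _) (le_theta_pow j.2 (hℓm i))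
  -- A block with `s i < 1` needs no bits. Elsewhere floor plus one, rather than the ceiling, keeps
  -- the inequality strict when the logarithm is an integer.
  refine ⟨fun i => if 1 ≤ s i then ⌊Real.logb 2 (s i)⌋₊ + 1 else 0, ?_, fun i => ?_⟩
  · rw [← Finset.sum_filter]
    -- Being integers, a total above `k` is at least `k + 1`; this is the saved bit.
    by_contra! hlt
    have h1 : (k : ℝ) + 1 ≤ ∑ i ∈ S, ((⌊Real.logb 2 (s i)⌋₊ : ℝ) + 1) := by exact_mod_cast hlt
    have h2 : ∑ i ∈ S, ((⌊Real.logb 2 (s i)⌋₊ : ℝ) + 1) ≤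
        ∑ i ∈ S, Real.logb 2 (s i) + S.card := by
      rw [Finset.sum_add_distrib]
      gcongr with i hi
      · exact Nat.floor_le (Real.logb_nonneg (by norm_num) (Finset.mem_filter.1 hi).2)
      · simp
    have h3 : S.card * Real.logb 2 √(m : ℝ) + ∑ i ∈ S, Real.logb 2 (s i) ≤
        ∑ i, max 0 (B i) := by
      calc _ = ∑ i ∈ S, (Real.logb 2 √(m : ℝ) + Real.logb 2 (s i)) := by
            rw [Finset.sum_add_distrib, Finset.sum_const, nsmul_eq_mul]
        _ ≤ ∑ i ∈ S, max 0 (B i) :=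
            Finset.sum_le_sum fun i hi => (hlog i hi).trans (le_max_right _ _)
        _ ≤ _ := Finset.sum_le_sum_of_subset_of_nonneg (Finset.subset_univ _)
            fun i _ _ => le_max_left _ _
    have h4 := sub_one_le_mul_logb_sqrt hcard
    linarith
  · change s i < 2 ^ (if 1 ≤ s i then ⌊Real.logb 2 (s i)⌋₊ + 1 else 0)
    split_ifs with h
    · have h1 := Nat.lt_floor_add_one (Real.logb 2 (s i))
      rw [Real.logb_lt_iff_lt_rpow (by norm_num) (by linarith)] at h1
      exact_mod_cast h1
    · simpa using h

end CanonicalForm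

/-! ### Change of state coordinates -/

section ChangeOfCoordinates

variable {X Y : Type*} [Fintype X] [DecidableEq X]

theorem conj_pow_mulVec {T : Matrix X X ℝ} (hT : IsUnit T.det) (F : Matrix X X ℝ) (j : ℕ)
    (x : X → ℝ) : ((T * F * T⁻¹) ^ j) *ᵥ (T *ᵥ x) = T *ᵥ ((F ^ j) *ᵥ x) := by
  induction j with
  | zero => simp
  | succ j ih =>
    have h : T * F * T⁻¹ * T = T * F := by
      rw [Matrix.mul_assoc, Matrix.nonsing_inv_mul _ hT, Matrix.mul_one]
    rw [pow_succ', ← Matrix.mulVec_mulVec, ih, pow_succ']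
    simp only [Matrix.mulVec_mulVec, ← Matrix.mul_assoc, h]

theorem conj_mulVec {T : Matrix X X ℝ} (hT : IsUnit T.det) (F : Matrix X X ℝ) (x : X → ℝ) :
    (T * F * T⁻¹) *ᵥ (T *ᵥ x) = T *ᵥ (F *ᵥ x) := by
  simpa using conj_pow_mulVec hT F 1 x

theorem mul_inv_mulVec {T : Matrix X X ℝ} (hT : IsUnit T.det) (H : Matrix Y X ℝ) (x : X → ℝ) :
    (H * T⁻¹) *ᵥ (T *ᵥ x) = H *ᵥ x := by
  rw [Matrix.mulVec_mulVec, Matrix.mul_assoc, Matrix.nonsing_inv_mul _ hT, Matrix.mul_one]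

end ChangeOfCoordinates

end AnytimeControl

/-! ### The main theorem -/

theorem mainTheorem5
    -- dimensions and the plant
    {q r : ℕ} {ℓ : Fin q → ℕ} {U : Type*} [Fintype U]
    (F : Matrix (AnytimeControl.Idx ℓ) (AnytimeControl.Idx ℓ) ℝ)
    (G : Matrix (AnytimeControl.Idx ℓ) U ℝ)
    (H : Matrix (Fin q ⊕ Fin r) (AnytimeControl.Idx ℓ) ℝ)
    (hF : 1 < AnytimeControl.specRadius F)
    (hFG : AnytimeControl.IsControllable F G)
    -- a change of state coordinates that brings the plant into canonical form
    (T : Matrix (AnytimeControl.Idx ℓ) (AnytimeControl.Idx ℓ) ℝ) (hT : IsUnit T.det)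
    (a : (i : Fin q) → Fin (ℓ i) → ℝ)
    (hcan : AnytimeControl.IsCanonicalForm a (T * F * T⁻¹) (H * T⁻¹))
    -- bounds on the noises and on the initial state
    (W V X₀ : ℝ)
    -- the channel and the code
    {n k : ℕ} {𝒵 : Type*} {Ξ : Type*} [MeasurableSpace 𝒵] [MeasurableSpace Ξ]
    (ch : AnytimeControl.Channel n 𝒵 Ξ) (code : AnytimeControl.Code n k 𝒵) (R β : ℝ)
    (hcode : AnytimeControl.IsAnytimeReliable ch code R β)
    (hR : AnytimeControl.rateThreshold n a < R)
    (hβ : 2 / (n : ℝ) * Real.logb 2 (AnytimeControl.specRadius F) < β) :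
    ∃ S : AnytimeControl.Scheme (Fin q ⊕ Fin r) U k,
      AnytimeControl.StabilizesMeanSquare F G H ch code W V X₀ S := by
  open AnytimeControl in
  have hRk : R = (k : ℝ) / n := by
    obtain ⟨_, _, h, _⟩ := hcode
    exact h
  have hn : (0 : ℝ) < n := by
    rcases Nat.eq_zero_or_pos n with rfl | hn
    · simp [hRk, rateThreshold] at hR
    · exact_mod_cast hn
  obtain ⟨κ, hκ, hc⟩ := exists_bit_allocation a (hRk ▸ hR)
  have hβ' : specRadius F ^ 2 * (2 : ℝ) ^ (-(n * β)) < 1 := by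
    have hρ : 0 < specRadius F := by linarith
    have h1 : Real.logb 2 (specRadius F ^ 2) < n * β := by
      rw [Real.logb_pow]
      rw [div_mul_eq_mul_div, div_lt_iff₀ hn] at hβ
      push_cast
      linarith
    rw [Real.logb_lt_iff_lt_rpow (by norm_num) (by positivity)] at h1
    rw [Real.rpow_neg (by norm_num), ← div_eq_mul_inv, div_lt_one (by positivity)]
    exact h1
  obtain ⟨τ, hτ0, hτ⟩ := exists_norm_mulVec_le T
  obtain ⟨σ, hσ0, hσ⟩ := exists_norm_mulVec_le T⁻¹
  -- The estimator works on `T x`, so state noise and initial state are bounded with the factor `τ`,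
  -- and `σ` carries the error back; the measurements are the same in both coordinates.
  obtain ⟨enc, dec, ε, henc, hest⟩ :=
    hcan.exists_estimator κ hκ hc (τ * (W / 2)) (V / 2) (τ * X₀)
  refine exists_stabilizing_scheme F G H hF hFG (fun x hx => ?_) W V X₀ ch code R β hcode hβ'
    ⟨enc, fun m => T⁻¹ *ᵥ dec m, σ * ε, henc, fun x₀ w v p hx₀ hw hv hp0 hp t => ?_⟩
  · have h1 : T *ᵥ x = 0 := hcan.observable _ fun j => by
      rw [conj_pow_mulVec hT, mul_inv_mulVec hT, hx j]
    have h2 : T⁻¹ *ᵥ (T *ᵥ x) = x := by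
      rw [Matrix.mulVec_mulVec, Matrix.nonsing_inv_mul _ hT, Matrix.one_mulVec]
    rw [← h2, h1, Matrix.mulVec_zero]
  · have hTT : ∀ y, T *ᵥ (T⁻¹ *ᵥ y) = y := fun y => by
      rw [Matrix.mulVec_mulVec, Matrix.mul_nonsing_inv _ hT, Matrix.one_mulVec]
    have h1 := hest (fun t => T *ᵥ trajectory F x₀ w t) (fun t => T *ᵥ w t) v
      (fun t => T *ᵥ p t)
      ((hτ _).trans (mul_le_mul_of_nonneg_left hx₀ hτ0))
      (fun t => (hτ _).trans (mul_le_mul_of_nonneg_left (hw t) hτ0)) hv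
      (fun t => by rw [conj_mulVec hT, ← Matrix.mulVec_add]; rfl)
      (by simp [hp0])
      (fun t => by
        simp only [mul_inv_mulVec hT]
        rw [hp, Matrix.mulVec_add, hTT, Matrix.mulVec_mulVec]) t
    have h2 : trajectory F x₀ w t - p t =
        T⁻¹ *ᵥ (T *ᵥ trajectory F x₀ w t - T *ᵥ p t) := by
      rw [← Matrix.mulVec_sub, Matrix.mulVec_mulVec, Matrix.nonsing_inv_mul _ hT,
        Matrix.one_mulVec]
    rw [h2]
    exact (hσ _).trans (mul_le_mul_of_nonneg_left h1 hσ0)
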